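/- Let $K$ be a nonempty compact Hausdorff space (not necessarily metrizable), $T:K\to K$ a homeomorphism, and $\alpha_T$ the $^*$-automorphism $f\mapsto f\circ T$ of $C(K)=C(K,\mathbb{C})$. Then the Voiculescu--Brown entropy of $\alpha_T$, the contractive approximation (CA) entropy of $\alpha_T$ and the topological entropy of $T$ coincide: $$\mathrm{ht}(\alpha_T)=\mathrm{hc}(\alpha_T)=\mathrm{h}_{\mathrm{top}}(T).$$ The three quantities are defined as follows. (a) $\mathrm{h}_{\mathrm{top}}(T)=\sup_{\mathcal W}\lim_{n\to\infty}\frac1n\log N(\mathcal W\vee T^{-1}\mathcal W\vee\cdots\vee T^{-(n-1)}\mathcal W)$, where $\mathcal W$ runs over the finite open covers of $K$ and $N(\cdot)$ is the smallest cardinality of a subcover. (b) A CA embedding of a Banach space $X$ is a linear isometry $\iota:X\to Y$ into a Banach space $Y$ such that for every finite $\Omega\subseteq X$ and every $\delta>0$ there are $d\ge1$ and contractive linear maps $\phi:X\to\ell_\infty^d$, $\psi:\ell_\infty^d\to Y$ with $\|\psi\phi(x)-\iota(x)\|<\delta$ for all $x\in\Omega$; let $\mathrm{rc}(\Omega,\delta)$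 be the least such $d$. For an isometric automorphism $\alpha$ of $X$, $$\mathrm{hc}(\alpha)=\sup_{\Omega}\sup_{\delta>0}\limsup_{n\to\infty}\frac1n\log\mathrm{rc}(\Omega\cup\alpha\Omega\cup\cdots\cup\alpha^{n-1}\Omega,\delta),$$ where $\Omega$ runs over the finite subsets of $X$. The asserted equality holds for every choice of CA embedding $\iota$ of $C(K)$. (c) For a faithful $^*$-representation $\pi:A\to B(H)$ of a $C^*$-algebra $A$ on a Hilbert space, let $\mathrm{rcp}(\Omega,\delta)$ be the least rank of a finite-dimensional $C^*$-algebra $B$ (that is, the dimension of a maximal abelian $^*$-subalgebra of $B$) for which there are contractive completely positive maps $\phi:A\to B$, $\psi:B\to B(H)$ with $\|\psi\phi(a)-\pi(a)\|<\delta$ for all $a\in\Omega$. For a $^*$-automorphism $\alpha$ of $A$, $$\mathrm{ht}(\alpha)=\sup_{\Omega}\sup_{\delta>0}\limsup_{n\to\infty}\frac1n\log\mathrm{rcp}(\Omega\cup\alpha\Omega\cup\cdots\cup\alpha^{n-1}\Omega,\delta),$$ where $\Omega$ runs over the finite subsets of $A$. The asserted equality holds for every choice of faithful representation $\pi$ of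 $C(K)$. -/

import Mathlib

open Filter Topology Set
open scoped ComplexOrder

universe u v w

noncomputable section

/-! ### Topological entropy through finite open covers -/

section TopologicalEntropy

variable {K : Type*}

/-- `W` is a finite open cover of `K`. -/
structure IsFiniteOpenCover [TopologicalSpace K] (W : Set (Set K)) : Prop where
  finite : W.Finite
  isOpen : ∀ A ∈ W, IsOpen A
  sUnion_eq : ⋃₀ W = univ

/-- The smallest cardinality of a subcover of the cover `C` of `K`. -/
def subcoverNumber (C : Set (Set K)) : ℕ∞ :=
  ⨅ (s : Set (Set K)) (_ : s ⊆ C ∧ ⋃₀ s = univ), s.encard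

/-- The join `W ∨ T⁻¹ W ∨ ⋯ ∨ T^{-(n-1)} W`: all sets
`A₀ ∩ T⁻¹ A₁ ∩ ⋯ ∩ T^{-(n-1)} A_{n-1}` with `A₀, …, A_{n-1} ∈ W`. -/
def iteratedJoin (T : K → K) (W : Set (Set K)) (n : ℕ) : Set (Set K) :=
  {B | ∃ A : ℕ → Set K, (∀ k < n, A k ∈ W) ∧ B = ⋂ k < n, T^[k] ⁻¹' A k}

/-- The entropy `lim (1/n) log N(W ∨ T⁻¹ W ∨ ⋯ ∨ T^{-(n-1)} W)` of `T` relative to a cover `W`;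
the limit exists, see `tendsto_coverEntropyOf`. -/
def coverEntropyOf (T : K → K) (W : Set (Set K)) : EReal :=
  limsup (fun n : ℕ ↦
    ENNReal.log ((subcoverNumber (iteratedJoin T W n) : ℕ∞) : ENNReal) / (n : EReal)) atTop

/-- The topological entropy of `T`, through finite open covers. -/
def topologicalEntropy [TopologicalSpace K] (T : K → K) : EReal :=
  ⨆ (W : Set (Set K)) (_ : IsFiniteOpenCover W), coverEntropyOf T W

lemma exists_subcover_of_ne_top {C : Set (Set K)} (h : subcoverNumber C ≠ ⊤) :
    ∃ s : Set (Set K), (s ⊆ C ∧ ⋃₀ s = univ) ∧ s.encard = subcoverNumber C := by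
  have hne : Nonempty {s : Set (Set K) // s ⊆ C ∧ ⋃₀ s = univ} := by
    by_contra hc
    apply h
    simp only [subcoverNumber, iInf_eq_top]
    intro s hs
    exact absurd ⟨⟨s, hs⟩⟩ hc
  obtain ⟨⟨s, hs⟩, h2⟩ := ENat.exists_eq_iInf
    (fun s : {s : Set (Set K) // s ⊆ C ∧ ⋃₀ s = univ} ↦ s.1.encard)
  exact ⟨s, hs, h2.trans iInf_subtype⟩

lemma one_le_subcoverNumber [Nonempty K] (C : Set (Set K)) : 1 ≤ subcoverNumber C := by
  refine le_iInf₂ fun s hs ↦ ?_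
  rw [Set.one_le_encard_iff_nonempty]
  by_contra h
  rw [Set.not_nonempty_iff_eq_empty] at h
  have h2 := hs.2
  rw [h, sUnion_empty] at h2
  exact Set.empty_ne_univ h2

lemma iteratedJoin_finite (T : K → K) {W : Set (Set K)} (hW : W.Finite) (n : ℕ) :
    (iteratedJoin T W n).Finite := by
  have : Finite W := hW
  refine (Set.finite_range fun f : Fin n → W ↦ ⋂ k : Fin n, T^[k] ⁻¹' (f k : Set K)).subset ?_
  rintro B ⟨A, hA, rfl⟩
  refine ⟨fun k ↦ ⟨A k, hA k k.2⟩, ?_⟩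
  ext x
  simp [Fin.forall_iff]

lemma sUnion_iteratedJoin (T : K → K) {W : Set (Set K)} (hW : ⋃₀ W = univ) (n : ℕ) :
    ⋃₀ iteratedJoin T W n = univ := by
  refine eq_univ_of_forall fun x ↦ ?_
  have (k : ℕ) : ∃ A ∈ W, T^[k] x ∈ A := by
    have : T^[k] x ∈ ⋃₀ W := hW ▸ mem_univ _
    exact this
  choose A hA hx using this
  exact ⟨_, ⟨A, fun k _ ↦ hA k, rfl⟩, by simpa using fun k _ ↦ hx k⟩

lemma subcoverNumber_ne_top (T : K → K) {W : Set (Set K)} (hW : W.Finite) (hc : ⋃₀ W = univ)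
    (n : ℕ) : subcoverNumber (iteratedJoin T W n) ≠ ⊤ := by
  have h : subcoverNumber (iteratedJoin T W n) ≤ (iteratedJoin T W n).encard :=
    iInf₂_le _ ⟨subset_rfl, sUnion_iteratedJoin T hc n⟩
  exact ne_top_of_le_ne_top (Set.encard_ne_top_iff.2 (iteratedJoin_finite T hW n)) h

lemma subcoverNumber_iteratedJoin_add_le (T : K → K) {W : Set (Set K)} (hW : W.Finite)
    (hc : ⋃₀ W = univ) (m n : ℕ) :
    subcoverNumber (iteratedJoin T W (m + n)) ≤
      subcoverNumber (iteratedJoin T W m) * subcoverNumber (iteratedJoin T W n) := by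
  obtain ⟨s, ⟨hs, hsc⟩, hsN⟩ := exists_subcover_of_ne_top (subcoverNumber_ne_top T hW hc m)
  obtain ⟨t, ⟨ht, htc⟩, htN⟩ := exists_subcover_of_ne_top (subcoverNumber_ne_top T hW hc n)
  rw [← hsN, ← htN, ← Set.encard_prod]
  refine le_trans (iInf₂_le ((fun p : Set K × Set K ↦ p.1 ∩ T^[m] ⁻¹' p.2) '' (s ×ˢ t)) ⟨?_, ?_⟩)
    (Set.encard_image_le _ _)
  · rintro _ ⟨⟨B, D⟩, ⟨hB, hD⟩, rfl⟩
    obtain ⟨A, hA, rfl⟩ := hs hB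
    obtain ⟨A', hA', rfl⟩ := ht hD
    refine ⟨fun k ↦ if k < m then A k else A' (k - m), fun k hk ↦ ?_, ?_⟩
    · dsimp only
      split_ifs with h
      · exact hA k h
      · exact hA' _ (by omega)
    · ext x
      simp only [mem_inter_iff, mem_iInter, mem_preimage]
      constructor
      · rintro ⟨h1, h2⟩ k hk
        split_ifs with h
        · exact h1 k h
        · have := h2 (k - m) (by omega)
          rwa [← Function.iterate_add_apply, Nat.sub_add_cancel (by omega)] at this
      · intro h
        refine ⟨fun k hk ↦ by simpa [hk] using h k (by omega), fun k hk ↦ ?_⟩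
        have := h (k + m) (by omega)
        rw [← Function.iterate_add_apply]
        simpa using this
  · refine eq_univ_of_forall fun x ↦ ?_
    obtain ⟨B, hB, hxB⟩ : x ∈ ⋃₀ s := hsc ▸ mem_univ _
    obtain ⟨D, hD, hxD⟩ : T^[m] x ∈ ⋃₀ t := htc ▸ mem_univ _
    exact ⟨_, ⟨(B, D), ⟨hB, hD⟩, rfl⟩, hxB, hxD⟩

/-- The limit defining the entropy relative to a finite cover exists. -/
theorem tendsto_coverEntropyOf [Nonempty K] (T : K → K) {W : Set (Set K)} (hW : W.Finite)
    (hc : ⋃₀ W = univ) :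
    Tendsto (fun n : ℕ ↦
      ENNReal.log ((subcoverNumber (iteratedJoin T W n) : ℕ∞) : ENNReal) / (n : EReal))
      atTop (𝓝 (coverEntropyOf T W)) := by
  have hN (n : ℕ) : ∃ a : ℕ, 1 ≤ a ∧ subcoverNumber (iteratedJoin T W n) = (a : ℕ∞) := by
    obtain ⟨a, ha⟩ := ENat.ne_top_iff_exists.1 (subcoverNumber_ne_top T hW hc n)
    refine ⟨a, ?_, ha.symm⟩
    have := one_le_subcoverNumber (iteratedJoin T W n)
    rw [← ha] at this
    exact_mod_cast this
  choose a ha1 ha using hN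
  have hpos (n : ℕ) : (0 : ℝ) < a n := by exact_mod_cast ha1 n
  have hsub : Subadditive fun n ↦ Real.log (a n) := fun m n ↦ by
    rw [← Real.log_mul (hpos m).ne' (hpos n).ne']
    apply Real.log_le_log (hpos _)
    have := subcoverNumber_iteratedJoin_add_le T hW hc m n
    rw [ha, ha, ha] at this
    exact_mod_cast this
  have hlim := hsub.tendsto_lim ⟨0, by
    rintro _ ⟨n, rfl⟩
    exact div_nonneg (Real.log_nonneg (by exact_mod_cast ha1 n)) n.cast_nonneg⟩
  have heq : (fun n : ℕ ↦
      ENNReal.log ((subcoverNumber (iteratedJoin T W n) : ℕ∞) : ENNReal) / (n : EReal)) =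
      fun n : ℕ ↦ ((Real.log (a n) / n : ℝ) : EReal) := by
    funext n
    rw [ha, ENat.toENNReal_coe, ENNReal.log_pos_real' (by simpa [Nat.pos_iff_ne_zero, Nat.one_le_iff_ne_zero] using ha1 n), EReal.coe_div]
    simp
  have h2 : Tendsto (fun n : ℕ ↦ ((Real.log (a n) / n : ℝ) : EReal)) atTop
      (𝓝 ((hsub.lim : ℝ) : EReal)) := (continuous_coe_real_ereal.tendsto _).comp hlim
  rw [← heq] at h2
  rwa [coverEntropyOf, h2.limsup_eq]

end TopologicalEntropy

/-- The set `Ω ∪ α Ω ∪ ⋯ ∪ α^{n-1} Ω`. -/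
def orbitUnion {X : Type*} (α : X → X) (Ω : Set X) (n : ℕ) : Set X :=
  ⋃ k < n, α^[k] '' Ω

/-! ### Contractive approximation entropy -/

section CA

variable {X Y : Type*} [NormedAddCommGroup X] [NormedSpace ℂ X]
  [NormedAddCommGroup Y] [NormedSpace ℂ Y]

/-- There is a contractive factorization `X → ℓ_∞^d → Y` through `ℓ_∞^d`, `d ≥ 1`, which
approximates `γ` within `δ` on `Ω` (`Fin d → ℂ` carries the supremum norm). -/
def HasCA (γ : X →L[ℂ] Y) (Ω : Set X) (δ : ℝ) (d : ℕ) : Prop :=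
  0 < d ∧ ∃ (φ : X →L[ℂ] (Fin d → ℂ)) (ψ : (Fin d → ℂ) →L[ℂ] Y),
    ‖φ‖ ≤ 1 ∧ ‖ψ‖ ≤ 1 ∧ ∀ x ∈ Ω, ‖ψ (φ x) - γ x‖ < δ

/-- CA embeddings: isometric linear maps that can be approximated through finite-dimensional
`ℓ_∞`-spaces on all finite sets. -/
def IsCAEmbedding (ι : X →ₗᵢ[ℂ] Y) : Prop :=
  ∀ (Ω : Finset X) (δ : ℝ), 0 < δ → ∃ d : ℕ, HasCA ι.toContinuousLinearMap (Ω : Set X) δ d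

/-- The contractive `δ`-rank of `Ω`, computed with the CA embedding `ι`. -/
def contractiveRank (ι : X →ₗᵢ[ℂ] Y) (Ω : Set X) (δ : ℝ) : ℕ∞ :=
  ⨅ (d : ℕ) (_ : HasCA ι.toContinuousLinearMap Ω δ d), (d : ℕ∞)

/-- The contractive approximation entropy of an isometric automorphism `α` of `X`, computed with
the CA embedding `ι`. -/
def caEntropy (ι : X →ₗᵢ[ℂ] Y) (α : X ≃ₗᵢ[ℂ] X) : EReal :=
  ⨆ (Ω : Finset X) (δ : ℝ) (_ : 0 < δ),
    limsup (fun n : ℕ ↦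
      ENNReal.log ((contractiveRank ι (orbitUnion α (Ω : Set X) n) δ : ℕ∞) : ENNReal) / (n : EReal))
      atTop

end CA

/-! ### Voiculescu–Brown entropy -/

section VoiculescuBrown

/-- The rank of a finite-dimensional C⋆-algebra: the largest dimension of a commutative
⋆-subalgebra, that is, the dimension of a maximal abelian self-adjoint subalgebra. -/
def cstarRank (B : Type*) [CStarAlgebra B] : ℕ :=
  sSup {k : ℕ | ∃ S : StarSubalgebra ℂ B,
    (∀ x ∈ S, ∀ y ∈ S, x * y = y * x) ∧ Module.finrank ℂ S = k}

variable {A : Type*} [NonUnitalCStarAlgebra A] [PartialOrder A] [StarOrderedRing A]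
  {H : Type*} [NormedAddCommGroup H] [InnerProductSpace ℂ H] [CompleteSpace H]

/-- There is a factorization `A → B → B(H)` by contractive completely positive maps through a
finite-dimensional C⋆-algebra `B` of rank `r` which approximates the representation `π` within `δ`
on `Ω`. -/
def HasCPA (π : A →⋆ₙₐ[ℂ] (H →L[ℂ] H)) (Ω : Set A) (δ : ℝ) (r : ℕ) : Prop :=
  ∃ (B : Type) (_ : CStarAlgebra B) (_ : PartialOrder B) (_ : StarOrderedRing B)
    (φ : CompletelyPositiveMap A B) (ψ : CompletelyPositiveMap B (H →L[ℂ] H)),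
    FiniteDimensional ℂ B ∧ cstarRank B = r ∧
    (∀ a, ‖φ a‖ ≤ ‖a‖) ∧ (∀ b, ‖ψ b‖ ≤ ‖b‖) ∧ ∀ a ∈ Ω, ‖ψ (φ a) - π a‖ < δ

/-- The completely positive `δ`-rank of `Ω`, computed in the representation `π`. -/
def completelyPositiveRank (π : A →⋆ₙₐ[ℂ] (H →L[ℂ] H)) (Ω : Set A) (δ : ℝ) : ℕ∞ :=
  ⨅ (r : ℕ) (_ : HasCPA π Ω δ r), (r : ℕ∞)

/-- The Voiculescu–Brown entropy of a ⋆-automorphism `α` of `A`, computed in the faithful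
representation `π`. -/
def voiculescuBrownEntropy (π : A →⋆ₙₐ[ℂ] (H →L[ℂ] H)) (α : A ≃⋆ₐ[ℂ] A) : EReal :=
  ⨆ (Ω : Finset A) (δ : ℝ) (_ : 0 < δ),
    limsup (fun n : ℕ ↦
      ENNReal.log ((completelyPositiveRank π (orbitUnion α (Ω : Set A) n) δ : ℕ∞) : ENNReal) /
        (n : EReal))
      atTop

end VoiculescuBrown

/-! ### The induced automorphism of `C(K)` -/

section Induced

variable {K : Type*} [TopologicalSpace K]

/-- The ⋆-automorphism `f ↦ f ∘ T` of `C(K)`. -/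
def inducedAut (T : K ≃ₜ K) : C(K, ℂ) ≃⋆ₐ[ℂ] C(K, ℂ) :=
  T.compStarAlgEquiv' ℂ ℂ

theorem inducedAut_apply (T : K ≃ₜ K) (f : C(K, ℂ)) (x : K) : inducedAut T f x = f (T x) := rfl

/-- The ⋆-automorphism `f ↦ f ∘ T` of `C(K)` as an isometric automorphism of a Banach space. -/
def inducedIsometry [CompactSpace K] (T : K ≃ₜ K) : C(K, ℂ) ≃ₗᵢ[ℂ] C(K, ℂ) where
  toLinearEquiv := (inducedAut T).toAlgEquiv.toLinearEquiv
  norm_map' f := StarAlgEquiv.norm_map (inducedAut T) f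

theorem inducedIsometry_apply [CompactSpace K] (T : K ≃ₜ K) (f : C(K, ℂ)) :
    inducedIsometry T f = inducedAut T f := rfl

end Induced

end

noncomputable section

/-! ### Rank and minimal projections in finite-dimensional C⋆-algebras. -/

section FiniteDimensionalCStarAlgebra

/-! Upper bounds: if the functions in `Ω` oscillate little on the members of a cover `W`, then their
translates under `T` oscillate little on the members of the `n`-fold join. A partition of unity
subordinate to a minimal subcover, with one sample point per member, factors the orbit approximately
through `ℂ^N`, with `N` the size of the subcover (`exists_partition_approx`).

Lower bound: both kinds of factorization are reduced to `IsDominated`. The gauge is `ν f = ‖φ f‖`,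
and the functionals come from Hahn–Banach extensions of point evaluations. The `ℓ₁` control by the
rank comes from the coordinates of `ℓ_∞^d` in the CA case and from minimal projections in the
completely positive case (`sum_norm_le_cstarRank_mul`).

The core is `subcoverNumber_le_of_isDominated`. A star refinement of `W` by Urysohn functions
assigns words to points, and a maximal separated set `S` of words yields a subcover of the join with
at most `|S|` members. To each word belongs a bump function, the positive part of one minus a
multiple of the average of the Urysohn functions along the orbit. An almost-evaluation is at least
`1/2` on it (`half_le_functional`), so `∑ ν ≥ |S| / 2`. Only `exp(εn)` bumps overlap at any point,
because words tracking an orbit up to few errors are few (`card_words_le`); so `∑ ν ≤ r exp(εn)`.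
Thus the subcover number is at most `2 r exp(εn)`, and `ε` is arbitrary. -/

lemma finite_real_spectrum_of_finiteDimensional {B : Type*} [CStarAlgebra B]
    [FiniteDimensional ℂ B] (x : B) : (spectrum ℝ x).Finite := by
  have : FiniteDimensional ℝ B := FiniteDimensional.complexToReal B
  nontriviality B
  have hx : IsIntegral ℝ x := Algebra.IsIntegral.isIntegral x
  refine ((minpoly ℝ x).rootSet_finite ℝ).subset fun r hr ↦ ?_
  have h := spectrum.subset_polynomial_aeval x (minpoly ℝ x) ⟨r, hr, rfl⟩
  rw [minpoly.aeval, spectrum.zero_eq, mem_singleton_iff] at h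
  rw [Polynomial.mem_rootSet]
  exact ⟨minpoly.ne_zero hx, by simpa using h⟩

/-- Write `b = c⋆c`. Then `‖b‖ = ‖cc⋆‖`, the projections split `cc⋆` into the terms `c p c⋆`, and
each has norm `‖cp‖² = ‖p b p‖`. -/
lemma norm_le_sum_norm_compression {B : Type*} [CStarAlgebra B] [PartialOrder B]
    [StarOrderedRing B] {S : Finset B} (hS : ∀ p ∈ S, IsStarProjection p)
    (hsum : ∑ p ∈ S, p = 1) {b : B} (hb : 0 ≤ b) : ‖b‖ ≤ ∑ p ∈ S, ‖p * b * p‖ := by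
  obtain ⟨c, rfl⟩ := CStarAlgebra.nonneg_iff_eq_star_mul_self.1 hb
  have h1 : c * star c = ∑ p ∈ S, c * p * star c := by
    rw [← Finset.sum_mul, ← Finset.mul_sum, hsum, mul_one]
  rw [CStarRing.norm_star_mul_self, ← CStarRing.norm_self_mul_star, h1]
  refine (norm_sum_le _ _).trans (Finset.sum_le_sum fun p hp ↦ le_of_eq ?_)
  have hp1 : p * p = p := (hS p hp).isIdempotentElem
  have hp2 : star p = p := (hS p hp).isSelfAdjoint
  have e1 : c * p * star c = (c * p) * star (c * p) := by
    rw [star_mul, hp2, mul_assoc c p (p * _), ← mul_assoc p p, hp1, mul_assoc]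
  have e2 : p * (star c * c) * p = star (c * p) * (c * p) := by
    rw [star_mul, hp2]; simp only [mul_assoc]
  rw [e1, e2, CStarRing.norm_self_mul_star, CStarRing.norm_star_mul_self]

/-- A self-adjoint element of a corner which is not a multiple of the unit of the corner splits
that unit. -/
lemma exists_projection_split {B : Type*} [CStarAlgebra B] [FiniteDimensional ℂ B] {p x : B}
    (hp : IsStarProjection p) (hx : IsSelfAdjoint x) (hpx : p * x = x) (hxp : x * p = x)
    (hne : ∀ r : ℝ, x ≠ r • p) :
    ∃ e : B, IsStarProjection e ∧ p * e = e ∧ e * p = e ∧ e ≠ 0 ∧ e ≠ p := by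
  classical
  have hfin := finite_real_spectrum_of_finiteDimensional x
  have hcont (f : ℝ → ℝ) : ContinuousOn f (spectrum ℝ x) := hfin.continuousOn f
  -- Spectral projections of `x`. If nothing splits `p`, each `p * e r` is `0` or `p`, so `x = ∑ r •
  -- (p * e r)` is a multiple of `p`.
  let e (r : ℝ) : B := cfc (fun s : ℝ ↦ if s = r then (1 : ℝ) else 0) x
  have hcomm (r : ℝ) : p * e r = e r * p := by
    have h1 : Commute x p := hxp.trans hpx.symm
    exact ((h1.cfc_real _).eq).symm
  have hee (r : ℝ) : e r * e r = e r := by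
    simp only [e]
    rw [← cfc_mul _ _ _ (hcont _) (hcont _)]
    congr 1
    ext s
    split_ifs <;> simp
  have hsa (r : ℝ) : star (e r) = e r := (cfc_predicate (R := ℝ) (p := IsSelfAdjoint) _ x)
  have hpp : p * p = p := hp.isIdempotentElem
  have hps : star p = p := hp.isSelfAdjoint
  by_contra! hcon
  have key (r : ℝ) : ∃ c : ℝ, p * e r = c • p := by
    by_cases h0 : p * e r = 0
    · exact ⟨0, by simpa using h0⟩
    · refine ⟨1, ?_⟩
      rw [one_smul]
      refine hcon _ ⟨?_, ?_⟩ ?_ ?_ h0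
      · change p * e r * (p * e r) = p * e r
        have h1 : p * e r * p = p * e r := by rw [mul_assoc, ← hcomm, ← mul_assoc, hpp]
        rw [← mul_assoc, h1, mul_assoc, hee]
      · change star (p * e r) = p * e r
        rw [star_mul, hsa, hps, hcomm]
      · rw [← mul_assoc, hpp]
      · rw [mul_assoc, ← hcomm, ← mul_assoc, hpp]
  choose c hc using key
  have hxsum : x = ∑ r ∈ hfin.toFinset, r • e r := by
    have h1 : ∀ r ∈ hfin.toFinset,
        r • e r = cfc (fun s : ℝ ↦ r • (if s = r then (1 : ℝ) else 0)) x := fun r _ ↦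
      (cfc_smul r _ x (hcont _)).symm
    rw [Finset.sum_congr rfl h1, ← cfc_sum _ _ _ fun _ _ ↦ hcont _]
    conv_lhs => rw [← cfc_id ℝ x]
    refine cfc_congr fun s hs ↦ ?_
    simp [Finset.sum_apply, hs]
  refine hne (∑ r ∈ hfin.toFinset, r * c r) ?_
  refine hpx.symm.trans ((congrArg (p * ·) hxsum).trans ?_)
  simp only [Finset.mul_sum, Finset.sum_smul]
  refine Finset.sum_congr rfl fun r _ ↦ ?_
  rw [mul_smul_comm, hc, smul_smul]

/-- The ⋆-homomorphism `c ↦ ∑ c_p p` given by orthogonal projections of sum `1`. -/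
def projectionHom {B : Type*} [CStarAlgebra B] (S : Finset B)
    (hS : ∀ p ∈ S, IsStarProjection p) (horth : ∀ p ∈ S, ∀ q ∈ S, p ≠ q → p * q = 0)
    (hsum : ∑ p ∈ S, p = 1) : (S → ℂ) →⋆ₐ[ℂ] B where
  toFun c := ∑ p : S, c p • (p : B)
  map_one' := by
    simp only [Pi.one_apply, one_smul]
    rw [Finset.sum_coe_sort S (fun p ↦ p), hsum]
  map_mul' c d := by
    rw [Finset.sum_mul_sum]
    refine Finset.sum_congr rfl fun p _ ↦ ?_
    rw [Finset.sum_eq_single p]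
    · rw [smul_mul_smul_comm, (hS p p.2).isIdempotentElem]
      rfl
    · intro q _ hq
      rw [smul_mul_smul_comm, horth p p.2 q q.2 (Subtype.coe_injective.ne hq.symm),
        smul_zero]
    · simp
  map_zero' := by simp
  map_add' c d := by simp [add_smul, Finset.sum_add_distrib]
  commutes' r := by
    simp only [Pi.algebraMap_apply, ← Finset.smul_sum]
    rw [Finset.sum_coe_sort S (fun p ↦ p), hsum, Algebra.algebraMap_eq_smul_one r (A := B)]
    simp
  map_star' c := by
    rw [star_sum]
    refine Finset.sum_congr rfl fun p _ ↦ ?_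
    rw [star_smul, (hS p p.2).isSelfAdjoint]
    rfl

lemma bddAbove_finrank_commutative (B : Type*) [CStarAlgebra B] [FiniteDimensional ℂ B] :
    BddAbove {k : ℕ | ∃ S : StarSubalgebra ℂ B,
      (∀ x ∈ S, ∀ y ∈ S, x * y = y * x) ∧ Module.finrank ℂ S = k} := by
  refine ⟨Module.finrank ℂ B, ?_⟩
  rintro k ⟨S, -, rfl⟩
  exact Submodule.finrank_le (Subalgebra.toSubmodule S.toSubalgebra)

/-- The projections span a commutative ⋆-subalgebra, the range of `projectionHom`, and they are
linearly independent because multiplication by one of them isolates its coefficient. -/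
lemma card_projections_le_cstarRank {B : Type*} [CStarAlgebra B] [FiniteDimensional ℂ B]
    (S : Finset B) (hS : ∀ p ∈ S, IsStarProjection p) (h0 : ∀ p ∈ S, p ≠ 0)
    (horth : ∀ p ∈ S, ∀ q ∈ S, p ≠ q → p * q = 0) (hsum : ∑ p ∈ S, p = 1) :
    S.card ≤ cstarRank B := by
  let f := projectionHom S hS horth hsum
  have hf (c : S → ℂ) : f c = ∑ p : S, c p • (p : B) := rfl
  have hinj : Function.Injective f := by
    rw [injective_iff_map_eq_zero]
    intro c hc
    funext q
    have h1 : (q : B) * f c = c q • (q : B) := by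
      rw [hf, Finset.mul_sum, Finset.sum_eq_single q]
      · rw [mul_smul_comm, (hS q q.2).isIdempotentElem]
      · intro p _ hp
        rw [mul_smul_comm, horth q q.2 p p.2 (Subtype.coe_injective.ne hp.symm), smul_zero]
      · simp
    rw [hc, mul_zero, eq_comm, smul_eq_zero] at h1
    exact h1.resolve_right (h0 q q.2)
  refine le_csSup (bddAbove_finrank_commutative B) ⟨f.range, ?_, ?_⟩
  · rintro _ ⟨c, rfl⟩ _ ⟨d, rfl⟩
    change f c * f d = f d * f c
    rw [← map_mul, ← map_mul, mul_comm]
  · have := LinearMap.finrank_range_of_inj (f := f.toAlgHom.toLinearMap) hinj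
    rw [Module.finrank_fintype_fun_eq_card, Fintype.card_coe] at this
    exact this

/-- In a finite-dimensional C⋆-algebra, `1` is a sum of minimal projections. -/
lemma exists_minimal_projections (B : Type*) [CStarAlgebra B] [FiniteDimensional ℂ B] :
    ∃ S : Finset B, (∀ p ∈ S, IsStarProjection p) ∧ (∑ p ∈ S, p = 1) ∧ S.card ≤ cstarRank B ∧
      (∀ p ∈ S, p ≠ 0) ∧
      ∀ p ∈ S, ∀ x, IsSelfAdjoint x → ∃ r : ℝ, p * x * p = r • p := by
  classical
  let Q : Finset B → Prop := fun S ↦ (∀ p ∈ S, IsStarProjection p) ∧ (∀ p ∈ S, p ≠ 0) ∧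
    (∀ p ∈ S, ∀ q ∈ S, p ≠ q → p * q = 0) ∧ ∑ p ∈ S, p = 1
  have hbound (S : Finset B) (h : Q S) : S.card ≤ cstarRank B :=
    card_projections_le_cstarRank S h.1 h.2.1 h.2.2.1 h.2.2.2
  have hex : ∃ S, Q S := by
    rcases subsingleton_or_nontrivial B with hB | hB
    · exact ⟨∅, by simp, by simp, by simp, Subsingleton.elim _ _⟩
    · exact ⟨{1}, by simp, by simp, by simp, by simp⟩
  -- A family of largest cardinality consists of minimal projections: a non-scalar compression `p x
  -- p` would allow `p` to be replaced by `e` and `p - e`.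
  obtain ⟨S, hS, hmax⟩ : ∃ S, Q S ∧ ∀ S', Q S' → S'.card ≤ S.card := by
    obtain ⟨_, ⟨S, hS, rfl⟩, h2⟩ := BddAbove.exists_isGreatest_of_nonempty
      (S := {k | ∃ S, Q S ∧ S.card = k})
      ⟨cstarRank B, by rintro _ ⟨S, hS, rfl⟩; exact hbound S hS⟩
      ⟨_, hex.choose, hex.choose_spec, rfl⟩
    exact ⟨S, hS, fun S' h' ↦ h2 ⟨S', h', rfl⟩⟩
  refine ⟨S, hS.1, hS.2.2.2, hbound S hS, hS.2.1, fun p hp x hx ↦ ?_⟩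
  by_contra! hcon
  obtain ⟨hproj, h0, horth, hsum⟩ := hS
  have hpp : p * p = p := (hproj p hp).isIdempotentElem
  have hps : star p = p := (hproj p hp).isSelfAdjoint
  obtain ⟨e, he, hpe, hep, he0, hene⟩ := exists_projection_split (hproj p hp)
    (x := p * x * p) (by
      change star _ = _
      rw [star_mul, star_mul, hps, hx.star_eq, mul_assoc]) (by rw [← mul_assoc, ← mul_assoc, hpp])
    (by rw [mul_assoc, hpp]) hcon
  have hee : e * e = e := he.isIdempotentElem
  have hpe' : IsStarProjection (p - e) := by
    refine ⟨?_, (hproj p hp).isSelfAdjoint.sub he.isSelfAdjoint⟩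
    change (p - e) * (p - e) = p - e
    rw [mul_sub, sub_mul, sub_mul, hpp, hpe, hep, hee, sub_self, sub_zero]
  have hqe (q : B) (hq : q ∈ S) (hqp : q ≠ p) : q * e = 0 ∧ e * q = 0 := by
    constructor
    · rw [← hpe, ← mul_assoc, horth q hq p hp hqp, zero_mul]
    · rw [← hep, mul_assoc, horth p hp q hq hqp.symm, mul_zero]
  have hqe' (q : B) (hq : q ∈ S) (hqp : q ≠ p) : q * (p - e) = 0 ∧ (p - e) * q = 0 := by
    rw [mul_sub, sub_mul, (hqe q hq hqp).1, (hqe q hq hqp).2, horth q hq p hp hqp,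
      horth p hp q hq hqp.symm]
    simp
  have he1 : e * (p - e) = 0 := by rw [mul_sub, hep, hee, sub_self]
  have he2 : (p - e) * e = 0 := by rw [sub_mul, hpe, hee, sub_self]
  have hne : e ≠ p - e := fun h ↦ he0 (by rw [← hee]; nth_rw 2 [h]; exact he1)
  have hS1 : e ∉ S.erase p := fun h ↦ by
    obtain ⟨h1, h2⟩ := Finset.mem_erase.1 h
    exact he0 (hee ▸ (hqe e h2 h1).1)
  have hpe0 : p - e ≠ 0 := sub_ne_zero.2 hene.symm
  have hS2 : p - e ∉ S.erase p := fun h ↦ by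
    obtain ⟨h1, h2⟩ := Finset.mem_erase.1 h
    exact hpe0 (hpe'.isIdempotentElem.eq ▸ (hqe' _ h2 h1).1)
  have hS3 : e ∉ insert (p - e) (S.erase p) := by simp [hne, hS1]
  have hcard := hmax (insert e (insert (p - e) (S.erase p))) ⟨?_, ?_, ?_, ?_⟩
  · rw [Finset.card_insert_of_notMem hS3, Finset.card_insert_of_notMem hS2,
      Finset.card_erase_of_mem hp] at hcard
    have := Finset.card_pos.2 ⟨p, hp⟩
    omega
  · simp only [Finset.mem_insert, Finset.mem_erase]
    rintro q (rfl | rfl | ⟨-, hq⟩)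
    exacts [he, hpe', hproj q hq]
  · simp only [Finset.mem_insert, Finset.mem_erase]
    rintro q (rfl | rfl | ⟨-, hq⟩)
    exacts [he0, hpe0, h0 q hq]
  · simp only [Finset.mem_insert, Finset.mem_erase]
    rintro q (rfl | rfl | ⟨hqp, hq⟩) s (rfl | rfl | ⟨hsp, hs⟩) hqs
    exacts [absurd rfl hqs, he1, (hqe s hs hsp).2, he2, absurd rfl hqs, (hqe' s hs hsp).2,
      (hqe q hq hqp).1, (hqe' q hq hqp).1, horth q hq s hs hqs]
  · rw [Finset.sum_insert hS3, Finset.sum_insert hS2, ← add_assoc, add_sub_cancel,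
      Finset.add_sum_erase S (fun q ↦ q) hp, hsum]

/-- The rank of a finite-dimensional C⋆-algebra bounds the `ℓ₁`-norm of positive families. -/
theorem sum_norm_le_cstarRank_mul {B : Type*} [CStarAlgebra B] [PartialOrder B]
    [StarOrderedRing B] [FiniteDimensional ℂ B] {ι : Type*} (s : Finset ι) (b : ι → B)
    (hb : ∀ i ∈ s, 0 ≤ b i) : ∑ i ∈ s, ‖b i‖ ≤ cstarRank B * ‖∑ i ∈ s, b i‖ := by
  obtain ⟨S, hproj, hsum, hcard, h0, hmin⟩ := exists_minimal_projections B
  have key (p : B) (hp : p ∈ S) : ∑ i ∈ s, ‖p * b i * p‖ ≤ ‖∑ i ∈ s, b i‖ := by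
    have hp0 : 0 ≤ p := (hproj p hp).nonneg
    have hr (i : ι) : ∃ r : ℝ, i ∈ s → 0 ≤ r ∧ p * b i * p = r • p := by
      by_cases hi : i ∈ s
      · obtain ⟨r, hr⟩ := hmin p hp (b i) (hb i hi).isSelfAdjoint
        refine ⟨r, fun _ ↦ ⟨?_, hr⟩⟩
        have h1 : 0 ≤ p * b i * p := (hproj p hp).isSelfAdjoint.conjugate_nonneg (hb i hi)
        by_contra! hlt
        rw [hr] at h1
        have h2 : r • p = 0 := le_antisymm (smul_nonpos_of_nonpos_of_nonneg hlt.le hp0) h1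
        rcases smul_eq_zero.1 h2 with h | h
        exacts [hlt.ne h, h0 p hp h]
      · exact ⟨0, fun h ↦ absurd h hi⟩
    choose r hr using hr
    have hnp : ‖p‖ ≤ 1 := (hproj p hp).norm_le
    -- Compressions to a minimal projection are nonnegative multiples of `p`, so their norms add
    -- without loss.
    have h1 : ∑ i ∈ s, ‖p * b i * p‖ = ‖p * (∑ i ∈ s, b i) * p‖ := by
      rw [Finset.mul_sum, Finset.sum_mul, Finset.sum_congr rfl fun i hi ↦ (hr i hi).2,
        ← Finset.sum_smul, norm_smul, Real.norm_of_nonneg (Finset.sum_nonneg fun i hi ↦ (hr i hi).1),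
        Finset.sum_mul]
      refine Finset.sum_congr rfl fun i hi ↦ ?_
      rw [(hr i hi).2, norm_smul, Real.norm_of_nonneg (hr i hi).1]
    rw [h1]
    calc ‖p * (∑ i ∈ s, b i) * p‖ ≤ ‖p‖ * ‖∑ i ∈ s, b i‖ * ‖p‖ := norm_mul₃_le
      _ ≤ 1 * ‖∑ i ∈ s, b i‖ * 1 := by gcongr
      _ = _ := by ring
  calc ∑ i ∈ s, ‖b i‖ ≤ ∑ i ∈ s, ∑ p ∈ S, ‖p * b i * p‖ :=
        Finset.sum_le_sum fun i hi ↦ norm_le_sum_norm_compression hproj hsum (hb i hi)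
    _ = ∑ p ∈ S, ∑ i ∈ s, ‖p * b i * p‖ := Finset.sum_comm
    _ ≤ ∑ p ∈ S, ‖∑ i ∈ s, b i‖ := Finset.sum_le_sum key
    _ = S.card * ‖∑ i ∈ s, b i‖ := by simp
    _ ≤ cstarRank B * ‖∑ i ∈ s, b i‖ := by gcongr

end FiniteDimensionalCStarAlgebra

/-! ### Upper bounds by partitions of unity. -/

section UpperBounds

lemma exists_eq_star_mul_self_of_nonneg {D : Type*} [NonUnitalCStarAlgebra D] [PartialOrder D]
    [StarOrderedRing D] {a : D} (ha : 0 ≤ a) : ∃ x, a = star x * x :=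
  CStarAlgebra.nonneg_iff_eq_star_mul_self.1 ha

/-- The completely positive map `c ↦ ∑ c_j b_j⋆ b_j`. -/
def weightedSumCP {A : Type*} [NonUnitalCStarAlgebra A] [PartialOrder A] [StarOrderedRing A]
    {N : ℕ} (b : Fin N → A) : CompletelyPositiveMap (Fin N → ℂ) A where
  toFun c := ∑ j, c j • (star (b j) * b j)
  map_add' c d := by simp [add_smul, Finset.sum_add_distrib]
  map_smul' r c := by simp [Finset.smul_sum, mul_smul]
  map_cstarMatrix_nonneg' k M hM := by
    obtain ⟨X, rfl⟩ := exists_eq_star_mul_self_of_nonneg hM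
    -- The `j`-th coordinate of `X`, tensored with `b j`; the image of `X⋆X` is then a sum of
    -- squares `Z_j⋆ Z_j`.
    let Z (j : Fin N) : CStarMatrix (Fin k) (Fin k) A :=
      CStarMatrix.ofMatrix fun m l ↦ X m l j • b j
    have h : (star X * X).map (fun c : Fin N → ℂ ↦ ∑ j, c j • (star (b j) * b j)) =
        ∑ j, star (Z j) * Z j := by
      have hsum (i l : Fin k) (s : Finset (Fin N)) :
          (∑ j ∈ s, star (Z j) * Z j) i l = ∑ j ∈ s, (star (Z j) * Z j) i l := by
        classical
        induction s using Finset.induction_on with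
        | empty => rfl
        | insert a s ha ih => rw [Finset.sum_insert ha, Finset.sum_insert ha,
            CStarMatrix.add_apply, ih]
      ext i l
      rw [hsum, CStarMatrix.map_apply]
      refine Finset.sum_congr rfl fun j _ ↦ ?_
      rw [CStarMatrix.mul_apply, CStarMatrix.mul_apply, Finset.sum_apply, Finset.sum_smul]
      refine Finset.sum_congr rfl fun m _ ↦ ?_
      change (star (X m i j) * X m l j) • (star (b j) * b j) =
        star (X m i j • b j) * (X m l j • b j)
      rw [star_smul, smul_mul_smul_comm]
    change 0 ≤ (star X * X).map (fun c : Fin N → ℂ ↦ ∑ j, c j • (star (b j) * b j))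
    rw [h]
    exact Finset.sum_nonneg fun j _ ↦ star_mul_self_nonneg _

lemma weightedSumCP_apply {A : Type*} [NonUnitalCStarAlgebra A] [PartialOrder A]
    [StarOrderedRing A] {N : ℕ} (b : Fin N → A) (c : Fin N → ℂ) :
    weightedSumCP b c = ∑ j, c j • (star (b j) * b j) := rfl

lemma cstarRank_pi (N : ℕ) : cstarRank (Fin N → ℂ) = N := by
  refine le_antisymm (csSup_le ⟨_, ⊥, ?_, rfl⟩ ?_)
    (le_csSup (bddAbove_finrank_commutative _) ⟨⊤, fun x _ y _ ↦ mul_comm x y, ?_⟩)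
  · exact fun x _ y _ ↦ mul_comm x y
  · rintro k ⟨S, -, rfl⟩
    have h := Submodule.finrank_le (Subalgebra.toSubmodule S.toSubalgebra)
    rwa [Module.finrank_fin_fun] at h
  · have h : Module.finrank ℂ (⊤ : Submodule ℂ (Fin N → ℂ)) = N := by simp
    exact h

variable {K : Type*} [TopologicalSpace K]

lemma inducedAut_iterate_apply (T : K ≃ₜ K) (k : ℕ) (f : C(K, ℂ)) (x : K) :
    (inducedAut T)^[k] f x = f (T^[k] x) := by
  induction k generalizing x with
  | zero => rfl
  | succ k ih => rw [Function.iterate_succ_apply', inducedAut_apply, ih,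
      Function.iterate_succ_apply]

lemma isOpen_of_mem_iteratedJoin {T : K → K} (hT : Continuous T) {W : Set (Set K)}
    (hW : ∀ A ∈ W, IsOpen A) {n : ℕ} {B : Set K} (hB : B ∈ iteratedJoin T W n) : IsOpen B := by
  obtain ⟨A, hA, rfl⟩ := hB
  exact (finite_lt_nat n).isOpen_biInter fun k hk ↦ (hW _ (hA k hk)).preimage (hT.iterate k)

lemma exists_indexed_subcover (T : K ≃ₜ K) {W : Set (Set K)} (hW : IsFiniteOpenCover W) (n : ℕ) :
    ∃ (N : ℕ) (U : Fin N → Set K), (N : ℕ∞) = subcoverNumber (iteratedJoin T W n) ∧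
      (∀ j, IsOpen (U j)) ∧ (⋃ j, U j = univ) ∧ ∀ j, U j ∈ iteratedJoin T W n := by
  have hne := subcoverNumber_ne_top T hW.finite hW.sUnion_eq n
  obtain ⟨s, ⟨hs, hsU⟩, hcard⟩ := exists_subcover_of_ne_top hne
  have hfin : s.Finite := Set.encard_ne_top_iff.1 (hcard ▸ hne)
  have := hfin.fintype
  let e := Fintype.equivFin s
  refine ⟨Fintype.card s, fun j ↦ e.symm j, ?_, fun j ↦ ?_, ?_, fun j ↦ hs (e.symm j).2⟩
  · rw [← hcard, Set.encard_eq_coe_toFinset_card, Set.toFinset_card]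
  · exact isOpen_of_mem_iteratedJoin T.continuous hW.isOpen (hs (e.symm j).2)
  · rw [e.symm.surjective.iUnion_comp (fun B : s ↦ (B : Set K)), ← sUnion_eq_iUnion, hsU]

/-- For `f = g ∘ T^k`, the iterate `T^k` maps all of `B` into a single member of `W`, where `g`
varies by at most `ε`. -/
lemma small_oscillation_orbitUnion (T : K ≃ₜ K) {W : Set (Set K)} {Ω : Finset C(K, ℂ)} {ε : ℝ}
    (hosc : ∀ f ∈ Ω, ∀ A ∈ W, ∀ x ∈ A, ∀ y ∈ A, ‖f x - f y‖ ≤ ε) {n : ℕ} {B : Set K}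
    (hB : B ∈ iteratedJoin T W n) {f : C(K, ℂ)}
    (hf : f ∈ orbitUnion (inducedAut T) (Ω : Set C(K, ℂ)) n) {x y : K} (hx : x ∈ B) (hy : y ∈ B) :
    ‖f x - f y‖ ≤ ε := by
  obtain ⟨A, hA, rfl⟩ := hB
  obtain ⟨k, hk, g, hg, rfl⟩ := mem_iUnion₂.1 hf
  rw [inducedAut_iterate_apply, inducedAut_iterate_apply]
  exact hosc g hg _ (hA k hk) _ (mem_iInter₂.1 hx k hk) _ (mem_iInter₂.1 hy k hk)

variable [CompactSpace K]

lemma norm_weightedSum_le {N : ℕ} {b : Fin N → C(K, ℂ)} (hb : ∑ j, star (b j) * b j = 1)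
    (c : Fin N → ℂ) : ‖∑ j, c j • (star (b j) * b j)‖ ≤ ‖c‖ := by
  rw [ContinuousMap.norm_le _ (norm_nonneg _)]
  intro y
  have h1 : ∑ j, ‖b j y‖ ^ 2 = 1 := by
    have h := congrArg (fun f : C(K, ℂ) ↦ f y) hb
    simp only [ContinuousMap.sum_apply, ContinuousMap.mul_apply, ContinuousMap.star_apply,
      ContinuousMap.one_apply, RCLike.star_def, Complex.conj_mul'] at h
    exact_mod_cast h
  rw [ContinuousMap.sum_apply]
  calc ‖∑ j, (c j • (star (b j) * b j)) y‖ ≤ ∑ j, ‖c‖ * ‖b j y‖ ^ 2 := by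
        refine norm_sum_le_of_le _ fun j _ ↦ ?_
        simp only [ContinuousMap.smul_apply, ContinuousMap.mul_apply, ContinuousMap.star_apply,
          norm_smul, norm_mul, norm_star, ← sq]
        gcongr
        exact norm_le_pi_norm c j
    _ = ‖c‖ := by rw [← Finset.mul_sum, h1, mul_one]

/-- Functions of small oscillation on an open cover are approximated by a partition of unity. -/
lemma exists_partition_approx [T2Space K] [Nonempty K] {N : ℕ} {U : Fin N → Set K}
    (ho : ∀ j, IsOpen (U j)) (hU : ⋃ j, U j = univ) {Γ : Set C(K, ℂ)} {ε : ℝ} (hε : 0 ≤ ε)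
    (hosc : ∀ f ∈ Γ, ∀ j, ∀ x ∈ U j, ∀ y ∈ U j, ‖f x - f y‖ ≤ ε) :
    ∃ (x : Fin N → K) (b : Fin N → C(K, ℂ)), ∑ j, star (b j) * b j = 1 ∧
      ∀ f ∈ Γ, ‖∑ j, f (x j) • (star (b j) * b j) - f‖ ≤ ε := by
  obtain ⟨g, hg⟩ := PartitionOfUnity.exists_isSubordinate isClosed_univ U ho hU.ge
  -- Empty members of the cover receive an arbitrary sample point; their partition function
  -- vanishes.
  have hx (j : Fin N) : ∃ x : K, (U j).Nonempty → x ∈ U j := by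
    by_cases h : (U j).Nonempty
    · exact ⟨h.choose, fun _ ↦ h.choose_spec⟩
    · exact ⟨Classical.arbitrary K, fun h' ↦ absurd h' h⟩
  choose x hx using hx
  -- Square roots, so that the weights have the form `b⋆b` required by `weightedSumCP`.
  let b (j : Fin N) : C(K, ℂ) := ⟨fun y ↦ ((Real.sqrt (g j y) : ℝ) : ℂ), by fun_prop⟩
  have hbb (j : Fin N) (y : K) : (star (b j) * b j) y = (g j y : ℂ) := by
    have h : star (b j y) * b j y = (g j y : ℂ) := by
      simp only [b, ContinuousMap.coe_mk, RCLike.star_def, Complex.conj_ofReal]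
      rw [← Complex.ofReal_mul, Real.mul_self_sqrt (g.nonneg j y)]
    exact h
  have hg1 (y : K) : ∑ j, g j y = 1 := by
    rw [← finsum_eq_sum_of_fintype]; exact g.sum_eq_one (mem_univ y)
  refine ⟨x, b, ?_, fun f hf ↦ ?_⟩
  · ext y
    rw [ContinuousMap.sum_apply]
    simp only [hbb, ContinuousMap.one_apply]
    exact_mod_cast hg1 y
  · rw [ContinuousMap.norm_le _ hε]
    intro y
    have h1 : (∑ j, f (x j) • (star (b j) * b j) - f) y =
        ∑ j, (g j y : ℂ) * (f (x j) - f y) := by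
      simp only [ContinuousMap.sub_apply, ContinuousMap.sum_apply, ContinuousMap.smul_apply, hbb,
        mul_sub, Finset.sum_sub_distrib, ← Finset.sum_mul]
      rw [← Complex.ofReal_sum, hg1, Complex.ofReal_one, one_mul]
      simp [mul_comm]
    rw [h1]
    calc ‖∑ j, (g j y : ℂ) * (f (x j) - f y)‖ ≤ ∑ j, g j y * ε := by
          refine norm_sum_le_of_le _ fun j _ ↦ ?_
          rw [norm_mul, Complex.norm_real, Real.norm_of_nonneg (g.nonneg j y)]
          rcases eq_or_ne (g j y) 0 with h0 | h0
          · simp [h0]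
          · have hy : y ∈ U j := hg j (subset_tsupport _ h0)
            exact mul_le_mul_of_nonneg_left (hosc f hf j _ (hx j ⟨y, hy⟩) _ hy) (g.nonneg j y)
      _ = ε := by rw [← Finset.sum_mul, hg1, one_mul]

lemma hasCA_of_small_oscillation [T2Space K] [Nonempty K] {Y : Type*} [NormedAddCommGroup Y]
    [NormedSpace ℂ Y] (ι : C(K, ℂ) →ₗᵢ[ℂ] Y) {N : ℕ} {U : Fin N → Set K}
    (ho : ∀ j, IsOpen (U j)) (hU : ⋃ j, U j = univ) {Γ : Set C(K, ℂ)} {ε δ : ℝ} (hε : 0 ≤ ε)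
    (hδ : ε < δ) (hosc : ∀ f ∈ Γ, ∀ j, ∀ x ∈ U j, ∀ y ∈ U j, ‖f x - f y‖ ≤ ε) :
    HasCA ι.toContinuousLinearMap Γ δ N := by
  obtain ⟨x, b, hb, hf⟩ := exists_partition_approx ho hU hε hosc
  refine ⟨?_, LinearMap.mkContinuous
    { toFun := fun f j ↦ f (x j), map_add' := fun f g ↦ rfl, map_smul' := fun r f ↦ rfl } 1 ?_,
    ι.toContinuousLinearMap.comp (LinearMap.mkContinuous
      (weightedSumCP b).toLinearMap 1 ?_), ?_, ?_, ?_⟩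
  · rcases Nat.eq_zero_or_pos N with rfl | h
    · obtain ⟨j, -⟩ := mem_iUnion.1 (hU.ge (mem_univ (Classical.arbitrary K)))
      exact j.elim0
    · exact h
  · intro f
    rw [one_mul, pi_norm_le_iff_of_nonneg (norm_nonneg _)]
    exact fun j ↦ f.norm_coe_le_norm _
  · intro c
    rw [one_mul]
    exact norm_weightedSum_le hb c
  · exact LinearMap.mkContinuous_norm_le _ zero_le_one _
  · refine (ContinuousLinearMap.opNorm_comp_le _ _).trans ?_
    exact mul_le_one₀ ι.norm_toContinuousLinearMap_le (norm_nonneg _)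
      (LinearMap.mkContinuous_norm_le _ zero_le_one _)
  · intro f hfΓ
    refine lt_of_le_of_lt (le_of_eq ?_) ((hf f hfΓ).trans_lt hδ)
    rw [← ι.norm_map, map_sub]
    rfl

/-- Evaluation at the sample points is a ⋆-homomorphism, hence completely positive. The return map
is the weighted sum followed by `π`, again a weighted sum with weights `π(b_j)⋆ π(b_j)`. -/
lemma hasCPA_of_small_oscillation [T2Space K] [Nonempty K] {H : Type*} [NormedAddCommGroup H]
    [InnerProductSpace ℂ H] [CompleteSpace H] (π : C(K, ℂ) →⋆ₙₐ[ℂ] (H →L[ℂ] H)) {N : ℕ}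
    {U : Fin N → Set K} (ho : ∀ j, IsOpen (U j)) (hU : ⋃ j, U j = univ) {Γ : Set C(K, ℂ)}
    {ε δ : ℝ} (hε : 0 ≤ ε) (hδ : ε < δ)
    (hosc : ∀ f ∈ Γ, ∀ j, ∀ x ∈ U j, ∀ y ∈ U j, ‖f x - f y‖ ≤ ε) : HasCPA π Γ δ N := by
  obtain ⟨x, b, hb, hf⟩ := exists_partition_approx ho hU hε hosc
  have hψ (c : Fin N → ℂ) : weightedSumCP (fun j ↦ π (b j)) c =
      π (∑ j, c j • (star (b j) * b j)) := by
    rw [weightedSumCP_apply, map_sum]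
    refine Finset.sum_congr rfl fun j _ ↦ ?_
    rw [map_smul, map_mul, map_star]
  let ev : C(K, ℂ) →⋆ₙₐ[ℂ] (Fin N → ℂ) :=
    { toFun := fun f j ↦ f (x j)
      map_smul' := fun r f ↦ rfl
      map_zero' := rfl
      map_add' := fun f g ↦ rfl
      map_mul' := fun f g ↦ rfl
      map_star' := fun f ↦ rfl }
  refine ⟨Fin N → ℂ, inferInstance, inferInstance, inferInstance,
    CompletelyPositiveMapClass.toCompletelyPositiveLinearMap ev,
    weightedSumCP fun j ↦ π (b j), inferInstance, cstarRank_pi N, ?_, ?_, ?_⟩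
  · intro f
    rw [pi_norm_le_iff_of_nonneg (norm_nonneg _)]
    exact fun j ↦ f.norm_coe_le_norm _
  · intro c
    rw [hψ]
    exact (NonUnitalStarAlgHom.norm_apply_le π _).trans (norm_weightedSum_le hb c)
  · intro f hfΓ
    rw [hψ, ← map_sub]
    exact (NonUnitalStarAlgHom.norm_apply_le π _).trans_lt ((hf f hfΓ).trans_lt hδ)

/-- A finite cover of `K` by open sets on which the functions in `Ω` vary little. -/
lemma exists_cover_small_oscillation (Ω : Finset C(K, ℂ)) {ε : ℝ} (hε : 0 < ε) :
    ∃ W : Set (Set K), IsFiniteOpenCover W ∧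
      ∀ f ∈ Ω, ∀ A ∈ W, ∀ x ∈ A, ∀ y ∈ A, ‖f x - f y‖ ≤ ε := by
  let V (x : K) : Set K := ⋂ f ∈ Ω, f ⁻¹' Metric.ball (f x) (ε / 2)
  have hV (x : K) : IsOpen (V x) :=
    isOpen_biInter_finset fun f _ ↦ Metric.isOpen_ball.preimage f.continuous
  have hVx (x : K) : x ∈ V x := by simp [V, hε]
  obtain ⟨t, ht⟩ := isCompact_univ.elim_finite_subcover V hV fun x _ ↦ mem_iUnion.2 ⟨x, hVx x⟩
  refine ⟨V '' t, ⟨t.finite_toSet.image V, ?_, ?_⟩, ?_⟩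
  · rintro _ ⟨x, -, rfl⟩
    exact hV x
  · rw [sUnion_image]
    exact univ_subset_iff.1 ht
  · rintro f hf _ ⟨z, -, rfl⟩ x hx y hy
    have h1 : dist (f x) (f z) < ε / 2 := by simpa using mem_iInter₂.1 hx f hf
    have h2 : dist (f y) (f z) < ε / 2 := by simpa using mem_iInter₂.1 hy f hf
    rw [← dist_eq_norm]
    linarith [dist_triangle_right (f x) (f y) (f z)]

lemma log_div_mono {a b : ℕ∞} (h : a ≤ b) (n : ℕ) :
    ENNReal.log (a : ENNReal) / (n : EReal) ≤ ENNReal.log (b : ENNReal) / (n : EReal) :=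
  EReal.div_le_div_right_of_nonneg (by positivity)
    (ENNReal.log_monotone (by exact_mod_cast h))

theorem caEntropy_le_topologicalEntropy [T2Space K] [Nonempty K] (T : K ≃ₜ K) {Y : Type*}
    [NormedAddCommGroup Y] [NormedSpace ℂ Y] (ι : C(K, ℂ) →ₗᵢ[ℂ] Y) :
    caEntropy ι (inducedIsometry T) ≤ topologicalEntropy T := by
  refine iSup_le fun Ω ↦ iSup₂_le fun δ hδ ↦ ?_
  obtain ⟨W, hW, hosc⟩ := exists_cover_small_oscillation Ω (half_pos hδ)
  refine le_trans (limsup_le_limsup (Eventually.of_forall fun n ↦ log_div_mono ?_ n))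
    (le_iSup₂ (f := fun W (_ : IsFiniteOpenCover W) ↦ coverEntropyOf T W) W hW)
  obtain ⟨N, U, hN, ho, hU, hmem⟩ := exists_indexed_subcover T hW n
  rw [← hN]
  exact iInf₂_le N (hasCA_of_small_oscillation ι ho hU (half_pos hδ).le (half_lt_self hδ)
    fun f hf j x hx y hy ↦ small_oscillation_orbitUnion T hosc (hmem j) hf hx hy)

theorem voiculescuBrownEntropy_le_topologicalEntropy [T2Space K] [Nonempty K] (T : K ≃ₜ K)
    {H : Type*} [NormedAddCommGroup H] [InnerProductSpace ℂ H] [CompleteSpace H]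
    (π : C(K, ℂ) →⋆ₙₐ[ℂ] (H →L[ℂ] H)) :
    voiculescuBrownEntropy π (inducedAut T) ≤ topologicalEntropy T := by
  refine iSup_le fun Ω ↦ iSup₂_le fun δ hδ ↦ ?_
  obtain ⟨W, hW, hosc⟩ := exists_cover_small_oscillation Ω (half_pos hδ)
  refine le_trans (limsup_le_limsup (Eventually.of_forall fun n ↦ log_div_mono ?_ n))
    (le_iSup₂ (f := fun W (_ : IsFiniteOpenCover W) ↦ coverEntropyOf T W) W hW)
  obtain ⟨N, U, hN, ho, hU, hmem⟩ := exists_indexed_subcover T hW n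
  rw [← hN]
  exact iInf₂_le N (hasCPA_of_small_oscillation π ho hU (half_pos hδ).le (half_lt_self hδ)
    fun f hf j x hx y hy ↦ small_oscillation_orbitUnion T hosc (hmem j) hf hx hy)

end UpperBounds

/-! ### Counting sparse words. -/

section Counting

/-- Words of length `n` in the alphabet `Option (Fin m)` with at most `θ n` letters other than
`none` are few. -/
lemma card_words_le (m n : ℕ) {θ L : ℝ} (hL : 0 ≤ L) (S : Finset (Fin n → Option (Fin m)))
    (hS : ∀ u ∈ S, (((Finset.univ.filter fun k ↦ u k ≠ none).card : ℕ) : ℝ) ≤ θ * n) :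
    (S.card : ℝ) ≤ Real.exp ((L * θ + m * Real.exp (-L)) * n) := by
  -- Chernoff weights: a word in `S` has weight at least `exp(-Lθn)`, while all words together weigh
  -- `(1 + m exp(-L))^n`.
  let wt : Option (Fin m) → ℝ := fun o ↦ if o ≠ none then Real.exp (-L) else 1
  have hwt (o) : 0 ≤ wt o := by
    dsimp only [wt]; split_ifs <;> positivity
  have hprod (u : Fin n → Option (Fin m)) : ∏ k, wt (u k) =
      Real.exp (-L) ^ (Finset.univ.filter fun k ↦ u k ≠ none).card := by
    simp only [wt]
    rw [Finset.prod_ite]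
    simp
  have hlow (u) (hu : u ∈ S) : Real.exp (-(L * (θ * n))) ≤ ∏ k, wt (u k) := by
    rw [hprod, ← Real.exp_nat_mul, Real.exp_le_exp]
    nlinarith [mul_le_mul_of_nonneg_left (hS u hu) hL]
  have hsum : ∑ o, wt o = 1 + m * Real.exp (-L) := by
    rw [Fintype.sum_option]
    simp [wt]
  have h1 : S.card * Real.exp (-(L * (θ * n))) ≤ (1 + m * Real.exp (-L)) ^ n := by
    calc S.card * Real.exp (-(L * (θ * n))) = ∑ u ∈ S, Real.exp (-(L * (θ * n))) := by simp
      _ ≤ ∑ u ∈ S, ∏ k, wt (u k) := Finset.sum_le_sum hlow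
      _ ≤ ∑ u : Fin n → Option (Fin m), ∏ k, wt (u k) :=
        Finset.sum_le_sum_of_subset_of_nonneg (Finset.subset_univ S)
          fun u _ _ ↦ Finset.prod_nonneg fun k _ ↦ hwt _
      _ = (1 + m * Real.exp (-L)) ^ n := by
        rw [← hsum, Fintype.sum_pow]
  have h2 : (1 + m * Real.exp (-L)) ^ n ≤ Real.exp (m * Real.exp (-L) * n) := by
    rw [mul_comm _ (n : ℝ), Real.exp_nat_mul]
    gcongr
    rw [add_comm]
    exact Real.add_one_le_exp _
  rw [Real.exp_neg, ← div_eq_mul_inv, div_le_iff₀ (Real.exp_pos _)] at h1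
  refine h1.trans ((mul_le_mul_of_nonneg_right h2 (Real.exp_pos _).le).trans_eq ?_)
  rw [← Real.exp_add]
  ring_nf

/-- The order of choice matters: `L` first makes `m exp(-L)` small, then `θ` is taken small in terms
of `L`. -/
lemma exists_small_exponent (m : ℕ) {ε : ℝ} (hε : 0 < ε) :
    ∃ L θ : ℝ, 0 ≤ L ∧ 0 < θ ∧ θ ≤ 1 ∧ L * θ + m * Real.exp (-L) ≤ ε := by
  obtain ⟨L, hL0, hL⟩ : ∃ L : ℝ, 0 ≤ L ∧ m * Real.exp (-L) ≤ ε / 2 := by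
    have h : Tendsto (fun L : ℝ ↦ (m : ℝ) * Real.exp (-L)) atTop (𝓝 (m * 0)) :=
      (Real.tendsto_exp_neg_atTop_nhds_zero).const_mul _
    rw [mul_zero] at h
    exact ((eventually_ge_atTop 0).and (h.eventually (ge_mem_nhds (half_pos hε)))).exists
  refine ⟨L, min 1 (ε / (2 * (L + 1))), hL0, by positivity, min_le_left _ _, ?_⟩
  have h1 : L * min 1 (ε / (2 * (L + 1))) ≤ (L + 1) * (ε / (2 * (L + 1))) := by
    gcongr
    · linarith
    · exact min_le_right _ _
  have h2 : (L + 1) * (ε / (2 * (L + 1))) = ε / 2 := by field_simp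
  linarith

end Counting

/-! ### Star refinements by Urysohn functions. -/

section StarRefinement

variable {K : Type*} [TopologicalSpace K] [CompactSpace K] [T2Space K]

/-- A star refinement of a finite open cover given by Urysohn functions. -/
lemma exists_urysohn_star_refinement {W : Set (Set K)} (hW : IsFiniteOpenCover W) :
    ∃ (m : ℕ) (h : Fin m → C(K, ℝ)), (∀ p y, h p y ∈ Icc (0 : ℝ) 1) ∧ (∀ x, ∃ p, h p x = 0) ∧
      ∀ p, ∃ A ∈ W, ∀ q y, h p y ≠ 1 → h q y ≠ 1 → ∀ x, h q x = 0 → x ∈ A := by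
  let _ : UniformSpace K := uniformSpaceOfCompactR1
  obtain ⟨V, hV, hVW⟩ := lebesgue_number_lemma_sUnion isCompact_univ hW.isOpen hW.sUnion_eq.ge
  obtain ⟨V1, hV1, hsymm, hcomp⟩ := comp_comp_symm_mem_uniformity_sets hV
  have hf (c : K) : ∃ f : C(K, ℝ), f c = 0 ∧ (∀ y, f y ≠ 1 → (c, y) ∈ V1) ∧
      ∀ y, f y ∈ Icc (0 : ℝ) 1 := by
    obtain ⟨f, hf0, hf1, hf⟩ := exists_continuous_zero_one_of_isClosed (s := {c})
      (t := (interior (UniformSpace.ball c V1))ᶜ) isClosed_singleton isOpen_interior.isClosed_compl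
      (by simpa using mem_interior_iff_mem_nhds.2 (UniformSpace.ball_mem_nhds c hV1))
    refine ⟨f, hf0 rfl, fun y hy ↦ ?_, hf⟩
    by_contra hcon
    exact hy (hf1 fun h ↦ hcon (interior_subset h : y ∈ UniformSpace.ball c V1))
  choose f hf0 hf1 hf using hf
  obtain ⟨t, ht⟩ := isCompact_univ.elim_finite_subcover (fun c : K ↦ {y | f c y < 1 / 2})
    (fun c ↦ isOpen_lt (f c).continuous continuous_const)
    fun x _ ↦ mem_iUnion.2 ⟨x, by simp [hf0]⟩
  let e := t.equivFin
  -- The rescaling sends all values up to `1/2` to `0` and takes the value `1` only where `f` does,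
  -- so the zero sets cover while `h p ≠ 1` still forces `V1`-closeness to the centre.
  let h (p : Fin t.card) : C(K, ℝ) :=
    ⟨fun y ↦ max (2 * f (e.symm p) y - 1) 0, by fun_prop⟩
  have hh (p y) : h p y = max (2 * f (e.symm p) y - 1) 0 := rfl
  have hmem (p : Fin t.card) (y : K) (hy : h p y ≠ 1) : ((e.symm p : K), y) ∈ V1 := by
    refine hf1 _ y fun h1 ↦ hy ?_
    rw [hh, h1]; norm_num
  refine ⟨t.card, h, fun p y ↦ ⟨le_max_right _ _, ?_⟩, fun x ↦ ?_, fun p ↦ ?_⟩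
  · rw [hh, max_le_iff]
    exact ⟨by linarith [(hf (e.symm p) y).2], zero_le_one⟩
  · obtain ⟨c, hc, hx⟩ := mem_iUnion₂.1 (ht (mem_univ x))
    refine ⟨e ⟨c, hc⟩, ?_⟩
    rw [hh, e.symm_apply_apply]
    exact max_eq_right (by linarith [show f c x < 1 / 2 from hx])
  · obtain ⟨A, hA, hAV⟩ := hVW (e.symm p) (mem_univ _)
    refine ⟨A, hA, fun q y hp hq x hx ↦ hAV (hcomp ?_)⟩
    -- Three `V1`-steps: centre of `p`, then `y`, then centre of `q`, then `x`.
    exact SetRel.prodMk_mem_comp (SetRel.prodMk_mem_comp (hmem p y hp)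
      (SetRel.symm V1 (hmem q y hq))) (hmem q x (by rw [hx]; norm_num))

end StarRefinement

/-! ### The combinatorial lower bound for dominating ranks. -/

section LowerBound

variable {K : Type*} [TopologicalSpace K] [CompactSpace K]

/-- A real form of approximate factorization through a space of rank `r`: point evaluations are
approximated on `Γ` by linear functionals dominated by a contractive gauge `ν` whose `ℓ₁`-sums over
nonnegative families are controlled by `r`. -/
def IsDominated (Γ : Set C(K, ℝ)) (δ : ℝ) (r : ℕ) : Prop :=
  ∃ ν : C(K, ℝ) → ℝ, (∀ f, ν f ≤ ‖f‖) ∧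
    (∀ (ι : Type) (s : Finset ι) (F : ι → C(K, ℝ)), (∀ i ∈ s, 0 ≤ F i) →
      ∑ i ∈ s, ν (F i) ≤ r * ‖∑ i ∈ s, F i‖) ∧
    ∀ x, ∃ Λ : C(K, ℝ) →ₗ[ℝ] ℝ, (∀ f, Λ f ≤ ν f) ∧ ∀ f ∈ Γ, |Λ f - f x| < δ

/-- A contractive functional which is almost `1` at `1` and almost vanishes at functions `h k` is
large at the positive part of `1 - θ⁻¹ n⁻¹ ∑ h k`. -/
lemma half_le_functional {Λ : C(K, ℝ) →ₗ[ℝ] ℝ} (hΛ : ∀ f, Λ f ≤ ‖f‖) {θ δ : ℝ} (hθ : 0 < θ)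
    (hθ1 : θ ≤ 1) (hδ : δ = θ / 8) (h1 : 1 - δ ≤ Λ 1) {n : ℕ} (hn : 0 < n) (h : Fin n → C(K, ℝ))
    (h01 : ∀ k y, h k y ∈ Icc (0 : ℝ) 1) (hh : ∀ k, Λ (h k) ≤ δ) :
    1 / 2 ≤ Λ ((1 - (θ * n)⁻¹ • ∑ k, h k) ⊔ 0) := by
  have hn' : (0 : ℝ) < n := by exact_mod_cast hn
  set G : C(K, ℝ) := (θ * n)⁻¹ • ∑ k, h k with hG
  have hGy (y : K) : G y = (θ * n)⁻¹ * ∑ k, h k y := by simp [hG]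
  have hG0 (y : K) : 0 ≤ G y := by
    rw [hGy]
    exact mul_nonneg (by positivity) (Finset.sum_nonneg fun k _ ↦ (h01 k y).1)
  have hG1 (y : K) : G y ≤ θ⁻¹ := by
    have : ∑ k, h k y ≤ n := by
      simpa using Finset.sum_le_sum fun k (_ : k ∈ Finset.univ) ↦ (h01 k y).2
    rw [hGy]
    calc (θ * n)⁻¹ * ∑ k, h k y ≤ (θ * n)⁻¹ * n := by gcongr
      _ = θ⁻¹ := by field_simp
  have hΛG : Λ G ≤ 1 / 8 := by
    have : ∑ k, Λ (h k) ≤ n * δ := by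
      simpa using Finset.sum_le_sum fun k (_ : k ∈ Finset.univ) ↦ hh k
    rw [hG, map_smul, map_sum, smul_eq_mul]
    calc (θ * n)⁻¹ * ∑ k, Λ (h k) ≤ (θ * n)⁻¹ * (n * δ) := by gcongr
      _ = 1 / 8 := by rw [hδ]; field_simp
  set F : C(K, ℝ) := (1 - G) ⊔ 0 with hF
  have hFy (y : K) : F y = max (1 - G y) 0 := rfl
  -- Near-positivity of `Λ`: the function `F - 1 + G = (G - 1)⁺` lies between `0` and `θ⁻¹`.
  -- Contractivity with `Λ 1 ≥ 1 - δ` then gives `Λ (F - 1 + G) ≥ -1/8`.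
  have hnorm : ‖θ⁻¹ • (1 : C(K, ℝ)) - (F - 1 + G)‖ ≤ θ⁻¹ := by
    rw [ContinuousMap.norm_le _ (by positivity)]
    intro y
    simp only [ContinuousMap.sub_apply, ContinuousMap.add_apply, ContinuousMap.smul_apply,
      ContinuousMap.one_apply, hFy, smul_eq_mul, mul_one]
    rw [Real.norm_eq_abs, abs_le]
    have := (one_le_inv₀ hθ).2 hθ1
    rcases max_cases (1 - G y) 0 with ⟨e, h2⟩ | ⟨e, h2⟩ <;> rw [e] <;>
      constructor <;> linarith [hG0 y, hG1 y]
  have h2 := (hΛ _).trans hnorm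
  rw [map_sub, map_add, map_sub, map_smul, smul_eq_mul] at h2
  have h3 : θ⁻¹ * (1 - δ) ≤ θ⁻¹ * Λ 1 := by gcongr
  have h4 : θ⁻¹ * (1 - δ) = θ⁻¹ - 1 / 8 := by rw [hδ]; field_simp
  linarith

/-- The number of members of a subcover is bounded by a dominating rank. -/
theorem subcoverNumber_le_of_isDominated (T : K ≃ₜ K) {W : Set (Set K)} {m : ℕ}
    {h : Fin m → C(K, ℝ)} (h01 : ∀ p y, h p y ∈ Icc (0 : ℝ) 1) (hcov : ∀ x, ∃ p, h p x = 0)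
    (hstar : ∀ p, ∃ A ∈ W, ∀ q y, h p y ≠ 1 → h q y ≠ 1 → ∀ x, h q x = 0 → x ∈ A)
    {θ L : ℝ} (hL : 0 ≤ L) (hθ : 0 < θ) (hθ1 : θ ≤ 1) {n : ℕ} (hn : 0 < n) {Γ : Set C(K, ℝ)}
    (hΓ1 : 1 ∈ Γ) (hΓ : ∀ p, ∀ k < n, (h p).comp ⟨T^[k], T.continuous.iterate k⟩ ∈ Γ) {r : ℕ}
    (hdom : IsDominated Γ (θ / 8) r) :
    ∃ N : ℕ, subcoverNumber (iteratedJoin T W n) ≤ N ∧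
      (N : ℝ) ≤ 2 * Real.exp ((L * θ + m * Real.exp (-L)) * n) * r := by
  classical
  have hn' : (0 : ℝ) < n := by exact_mod_cast hn
  choose a ha using hcov
  choose A hAW hA using hstar
  let word (x : K) : Fin n → Fin m := fun k ↦ a (T^[k] x)
  -- Letters are related when the sets where their functions differ from `1` meet; distinct words of
  -- a separated set must have an unrelated pair of letters at some position.
  let R (p q : Fin m) : Prop := ∃ y, h p y ≠ 1 ∧ h q y ≠ 1
  let Q (S : Finset (Fin n → Fin m)) : Prop := (∀ w ∈ S, w ∈ range word) ∧
    ∀ w ∈ S, ∀ w' ∈ S, (∀ k, R (w k) (w' k)) → w = w'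
  obtain ⟨S, hSQ, hSmax⟩ := Finset.exists_max_image (Finset.univ.filter Q) Finset.card
    ⟨∅, by simp [Q]⟩
  obtain ⟨hSr, hSsep⟩ : Q S := (Finset.mem_filter.1 hSQ).2
  have hRrefl (x : K) (k : Fin n) : R (word x k) (word x k) := by
    refine ⟨T^[k] x, ?_⟩
    simp only [word, ha]; norm_num
  have hRsymm {p q : Fin m} : R p q → R q p := fun ⟨y, h1, h2⟩ ↦ ⟨y, h2, h1⟩
  -- By maximality of `S`. The star property then puts `T^[k] x` in `A (w k)` for every `k`.
  have hnear (x : K) : ∃ w ∈ S, ∀ k, R (w k) (word x k) := by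
    by_contra! hcon
    have hx : word x ∉ S := fun hx ↦ by
      obtain ⟨k, hk⟩ := hcon _ hx
      exact hk (hRrefl x k)
    have hQ : Q (insert (word x) S) := by
      refine ⟨fun w hw ↦ ?_, fun w hw w' hw' hR ↦ ?_⟩
      · rcases Finset.mem_insert.1 hw with rfl | hw
        exacts [⟨x, rfl⟩, hSr w hw]
      · rcases Finset.mem_insert.1 hw with rfl | hw <;> rcases Finset.mem_insert.1 hw' with rfl | hw'
        · rfl
        · obtain ⟨k, hk⟩ := hcon _ hw'
          exact absurd (hRsymm (hR k)) hk
        · obtain ⟨k, hk⟩ := hcon _ hw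
          exact absurd (hR k) hk
        · exact hSsep w hw w' hw' hR
    have := hSmax _ (Finset.mem_filter.2 ⟨Finset.mem_univ _, hQ⟩)
    rw [Finset.card_insert_of_notMem hx] at this
    omega
  refine ⟨S.card, ?_, ?_⟩
  · let c (w : Fin n → Fin m) : Set K := ⋂ k : Fin n, T^[k] ⁻¹' A (w k)
    have hle : subcoverNumber (iteratedJoin T W n) ≤ (c '' S).encard := by
      refine iInf₂_le _ ⟨?_, eq_univ_of_forall fun x ↦ ?_⟩
      · rintro _ ⟨w, -, rfl⟩
        refine ⟨fun k ↦ if hk : k < n then A (w ⟨k, hk⟩) else ∅, fun k hk ↦ ?_, ?_⟩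
        · simp only [hk, dif_pos]
          exact hAW _
        · ext x
          simp only [c, mem_iInter, Fin.forall_iff]
          refine forall₂_congr fun k hk ↦ ?_
          simp [hk]
      · obtain ⟨w, hw, hR⟩ := hnear x
        refine ⟨c w, ⟨w, hw, rfl⟩, mem_iInter.2 fun k ↦ ?_⟩
        obtain ⟨y, h1, h2⟩ := hR k
        exact hA _ _ y h1 h2 _ (ha _)
    refine hle.trans ((encard_image_le _ _).trans_eq ?_)
    rw [encard_coe_eq_coe_finsetCard]
  · obtain ⟨ν, hν1, hνsum, hνx⟩ := hdom
    let hk (w : Fin n → Fin m) (k : Fin n) : C(K, ℝ) :=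
      (h (w k)).comp ⟨T^[k], T.continuous.iterate k⟩
    have hk_apply (w k y) : hk w k y = h (w k) (T^[k] y) := rfl
    let F (w : Fin n → Fin m) : C(K, ℝ) := (1 - (θ * n)⁻¹ • ∑ k, hk w k) ⊔ 0
    have hF_apply (w y) : F w y = max (1 - (θ * n)⁻¹ * ∑ k, h (w k) (T^[k] y)) 0 := by
      have : F w y = max (1 - ((θ * n)⁻¹ • ∑ k, hk w k) y) 0 := rfl
      rw [this]
      simp [hk_apply]
    have hF0 (w) : 0 ≤ F w := le_sup_right
    have hF1 (w y) : F w y ≤ 1 := by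
      rw [hF_apply]
      refine max_le ?_ zero_le_one
      have : 0 ≤ (θ * n)⁻¹ * ∑ k, h (w k) (T^[k] y) :=
        mul_nonneg (by positivity) (Finset.sum_nonneg fun k _ ↦ (h01 _ _).1)
      linarith
    have hhalf (w) (hw : w ∈ S) : 1 / 2 ≤ ν (F w) := by
      obtain ⟨x, rfl⟩ := hSr w hw
      obtain ⟨Λ, hΛν, hΛ⟩ := hνx x
      refine le_trans ?_ (hΛν _)
      refine half_le_functional (fun f ↦ (hΛν f).trans (hν1 f)) hθ hθ1 rfl ?_ hn _
        (fun k y ↦ h01 _ _) fun k ↦ ?_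
      · have := (abs_lt.1 (hΛ 1 hΓ1)).1
        rw [ContinuousMap.one_apply] at this
        linarith
      · have := (abs_lt.1 (hΛ _ (hΓ (word x k) k k.2))).2
        have h0 : ((h (word x k)).comp ⟨T^[k], T.continuous.iterate k⟩ : C(K, ℝ)) x = 0 := ha _
        rw [h0, sub_zero] at this
        exact this.le
    have hmult (y : K) : ∑ w ∈ S, F w y ≤ Real.exp ((L * θ + m * Real.exp (-L)) * n) := by
      let S' := S.filter fun w ↦ F w y ≠ 0
      -- Only the letters whose function equals `1` at `T^[k] y` are recorded. Where two words both
      -- record `none`, the point `T^[k] y` relates their letters, so separation makes the code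
      -- injective.
      let code (w : Fin n → Fin m) : Fin n → Option (Fin m) :=
        fun k ↦ if h (w k) (T^[k] y) = 1 then some (w k) else none
      have hinj : Set.InjOn code S' := by
        intro w hw w' hw' hww
        have hwS := (Finset.mem_filter.1 hw).1
        refine hSsep w hwS w' (Finset.mem_filter.1 hw').1 fun k ↦ ?_
        have hc : code w k = code w' k := congrFun hww k
        by_cases h1 : h (w k) (T^[k] y) = 1 <;> by_cases h2 : h (w' k) (T^[k] y) = 1
        · simp only [code, h1, h2, if_true, Option.some.injEq] at hc
          obtain ⟨x, rfl⟩ := hSr w hwS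
          rw [← hc]
          exact hRrefl x k
        · simp [code, h1, h2] at hc
        · simp [code, h1, h2] at hc
        · exact ⟨_, h1, h2⟩
      calc ∑ w ∈ S, F w y = ∑ w ∈ S', F w y := (Finset.sum_filter_ne_zero S).symm
        _ ≤ ∑ w ∈ S', 1 := Finset.sum_le_sum fun w _ ↦ hF1 w y
        _ = ((S'.image code).card : ℝ) := by
          rw [Finset.card_image_of_injOn hinj]; simp
        _ ≤ _ := card_words_le m n hL _ fun u hu ↦ ?_
      obtain ⟨w, hw, rfl⟩ := Finset.mem_image.1 hu
      have hwF := (Finset.mem_filter.1 hw).2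
      have hlt : ∑ k, h (w k) (T^[k] y) < θ * n := by
        by_contra! hge
        refine hwF ?_
        rw [hF_apply, max_eq_right]
        rw [sub_nonpos, inv_mul_eq_div, one_le_div (by positivity)]
        exact hge
      -- Each recorded letter contributes `1` to the sum, so fewer than `θ n` are recorded.
      refine le_trans ?_ hlt.le
      rw [Finset.card_filter, Nat.cast_sum]
      refine Finset.sum_le_sum fun k _ ↦ ?_
      by_cases h1 : h (w k) (T^[k] y) = 1
      · simp [code, h1]
      · simp only [code, h1, if_false, ne_eq, not_true_eq_false, Nat.cast_zero]
        exact (h01 _ _).1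
    have hnorm : ‖∑ w ∈ S, F w‖ ≤ Real.exp ((L * θ + m * Real.exp (-L)) * n) := by
      rw [ContinuousMap.norm_le _ (Real.exp_pos _).le]
      intro y
      rw [ContinuousMap.sum_apply, Real.norm_of_nonneg (Finset.sum_nonneg fun w _ ↦
        show 0 ≤ F w y from hF0 w y)]
      exact hmult y
    have h1 := hνsum _ S F fun w _ ↦ hF0 w
    have h2 : (S.card : ℝ) * (1 / 2) ≤ ∑ w ∈ S, ν (F w) := by
      simpa using Finset.sum_le_sum hhalf
    have h3 : r * ‖∑ w ∈ S, F w‖ ≤ r * Real.exp ((L * θ + m * Real.exp (-L)) * n) := by gcongr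
    linarith

end LowerBound

/-! ### From complex factorizations to real domination. -/

section Complexification

variable {K : Type*} [TopologicalSpace K]

/-- A real function as a complex function. -/
def complexify : C(K, ℝ) →ₗ[ℝ] C(K, ℂ) where
  toFun f := ⟨fun x ↦ (f x : ℂ), by fun_prop⟩
  map_add' f g := by ext x; simp
  map_smul' r f := by ext x; simp

lemma complexify_apply (f : C(K, ℝ)) (x : K) : complexify f x = (f x : ℂ) := rfl

lemma complexify_nonneg {f : C(K, ℝ)} (hf : 0 ≤ f) : 0 ≤ complexify f := by
  rw [ContinuousMap.le_def]
  exact fun x ↦ Complex.zero_le_real.2 (hf x)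

variable [CompactSpace K]

lemma norm_complexify (f : C(K, ℝ)) : ‖complexify f‖ = ‖f‖ := by
  simp only [ContinuousMap.norm_eq_iSup_norm, complexify_apply, Complex.norm_real]

/-- Point evaluations factor approximately through approximations of an isometric embedding. -/
lemma exists_real_functional {Z : Type*} [NormedAddCommGroup Z] [NormedSpace ℂ Z]
    (ι : C(K, ℂ) →ₗᵢ[ℂ] Z) (S : C(K, ℂ) →ₗ[ℂ] Z) {Γ : Set C(K, ℝ)} {δ : ℝ}
    (hS : ∀ f ∈ Γ, ‖S (complexify f) - ι (complexify f)‖ < δ) (x : K) :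
    ∃ Λ : C(K, ℝ) →ₗ[ℝ] ℝ, (∀ f, Λ f ≤ ‖S (complexify f)‖) ∧ ∀ f ∈ Γ, |Λ f - f x| < δ := by
  let e := ι.equivRange
  let ev : C(K, ℂ) →L[ℂ] ℂ := ContinuousMap.evalCLM ℂ x
  -- Hahn–Banach extends evaluation at `x` from the range of `ι` to `Z`, keeping norm at most `1`;
  -- `Λ` is the real part of `g ∘ S`.
  obtain ⟨g, hg, hgn⟩ := exists_extension_norm_eq (LinearMap.range ι.toLinearMap)
    (ev.comp e.symm.toLinearIsometry.toContinuousLinearMap)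
  have hg1 (z : Z) : ‖g z‖ ≤ ‖z‖ := by
    have : ‖g‖ ≤ 1 := by
      rw [hgn]
      refine ContinuousLinearMap.opNorm_le_bound _ zero_le_one fun z ↦ ?_
      rw [one_mul]
      exact (ContinuousMap.norm_coe_le_norm (e.symm z) x).trans_eq (e.symm.norm_map z)
    exact (g.le_of_opNorm_le this z).trans_eq (one_mul _)
  have hgι (f : C(K, ℂ)) : g (ι f) = f x := by
    have h := hg (e f)
    have h2 : (ev.comp e.symm.toLinearIsometry.toContinuousLinearMap) (e f) = e.symm (e f) x := rfl
    rw [h2, e.symm_apply_apply] at h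
    exact h
  let Λ : C(K, ℝ) →ₗ[ℝ] ℝ :=
    Complex.reLm ∘ₗ (g.toLinearMap ∘ₗ S).restrictScalars ℝ ∘ₗ complexify
  have hΛ (f) : Λ f = (g (S (complexify f))).re := rfl
  refine ⟨Λ, fun f ↦ ?_, fun f hf ↦ ?_⟩
  · exact ((Complex.re_le_norm _).trans (hg1 _))
  · have h : Λ f - f x = (g (S (complexify f) - ι (complexify f))).re := by
      rw [map_sub, hgι, Complex.sub_re, complexify_apply, Complex.ofReal_re, hΛ]
    rw [h]
    exact (Complex.abs_re_le_norm _).trans_lt ((hg1 _).trans_lt (hS f hf))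

/-- Rotating each value of `φ` to be nonnegative turns the sum into `φ G`, where `G` is a
combination of the `F i` with coefficients in the unit disc and so is dominated pointwise by their
sum. -/
lemma sum_norm_functional_le (φ : C(K, ℂ) →ₗ[ℂ] ℂ) (hφ : ∀ f, ‖φ f‖ ≤ ‖f‖) {ι : Type*}
    (s : Finset ι) (F : ι → C(K, ℝ)) (hF : ∀ i ∈ s, 0 ≤ F i) :
    ∑ i ∈ s, ‖φ (complexify (F i))‖ ≤ ‖∑ i ∈ s, F i‖ := by
  have hη (z : ℂ) : ∃ η : ℂ, ‖η‖ ≤ 1 ∧ η * z = ‖z‖ := by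
    rcases eq_or_ne z 0 with rfl | hz
    · exact ⟨0, by simp, by simp⟩
    · have hz' : (‖z‖ : ℂ) ≠ 0 := by simpa using hz
      refine ⟨‖z‖ / z, ?_, div_mul_cancel₀ _ hz⟩
      rw [norm_div, Complex.norm_real, norm_norm, div_self (norm_ne_zero_iff.2 hz)]
  choose η hη1 hη using hη
  let G : C(K, ℂ) := ∑ i ∈ s, η (φ (complexify (F i))) • complexify (F i)
  have h1 : φ G = ((∑ i ∈ s, ‖φ (complexify (F i))‖ : ℝ) : ℂ) := by
    rw [map_sum, Complex.ofReal_sum]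
    refine Finset.sum_congr rfl fun i _ ↦ ?_
    rw [map_smul, smul_eq_mul, hη]
  have h2 : ‖G‖ ≤ ‖∑ i ∈ s, F i‖ := by
    rw [ContinuousMap.norm_le _ (norm_nonneg _)]
    intro y
    refine le_trans ?_ ((le_abs_self _).trans ((∑ i ∈ s, F i).norm_coe_le_norm y))
    rw [ContinuousMap.sum_apply, ContinuousMap.sum_apply]
    refine norm_sum_le_of_le _ fun i hi ↦ ?_
    have h0 : 0 ≤ F i y := hF i hi y
    rw [ContinuousMap.smul_apply, complexify_apply, norm_smul, Complex.norm_real,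
      Real.norm_of_nonneg h0]
    exact mul_le_of_le_one_left h0 (hη1 _)
  have h3 := (hφ G).trans h2
  rw [h1, Complex.norm_real] at h3
  exact (le_abs_self _).trans h3

/-- The supremum norm is at most the sum over the `d` coordinates, and each coordinate of `φ` is a
contractive functional, to which `sum_norm_functional_le` applies. -/
lemma HasCA.isDominated {Y : Type*} [NormedAddCommGroup Y] [NormedSpace ℂ Y]
    {ι : C(K, ℂ) →ₗᵢ[ℂ] Y} {Γ : Set C(K, ℝ)} {δ : ℝ} {d : ℕ}
    (h : HasCA ι.toContinuousLinearMap (complexify '' Γ) δ d) : IsDominated Γ δ d := by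
  obtain ⟨-, φ, ψ, hφ, hψ, h⟩ := h
  have hφ' (f) : ‖φ f‖ ≤ ‖f‖ := (φ.le_of_opNorm_le hφ f).trans_eq (one_mul _)
  have hψ' (c) : ‖ψ c‖ ≤ ‖c‖ := (ψ.le_of_opNorm_le hψ c).trans_eq (one_mul _)
  refine ⟨fun f ↦ ‖φ (complexify f)‖, fun f ↦ (hφ' _).trans_eq (norm_complexify f),
    fun J s F hF ↦ ?_, fun x ↦ ?_⟩
  · calc ∑ i ∈ s, ‖φ (complexify (F i))‖
        ≤ ∑ i ∈ s, ∑ j, ‖φ (complexify (F i)) j‖ := by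
          refine Finset.sum_le_sum fun i _ ↦ ?_
          rw [pi_norm_le_iff_of_nonneg (by positivity)]
          exact fun j ↦ Finset.single_le_sum (f := fun j ↦ ‖φ (complexify (F i)) j‖)
            (fun _ _ ↦ norm_nonneg _) (Finset.mem_univ j)
      _ = ∑ j, ∑ i ∈ s, ‖φ (complexify (F i)) j‖ := Finset.sum_comm
      _ ≤ ∑ j : Fin d, ‖∑ i ∈ s, F i‖ := by
          refine Finset.sum_le_sum fun j _ ↦ ?_
          exact sum_norm_functional_le (LinearMap.proj j ∘ₗ φ.toLinearMap)
            (fun f ↦ (norm_le_pi_norm (φ f) j).trans (hφ' f)) s F hF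
      _ = d * ‖∑ i ∈ s, F i‖ := by simp
  · obtain ⟨Λ, h1, h2⟩ := exists_real_functional ι (ψ.comp φ).toLinearMap
      (fun f hf ↦ h _ (mem_image_of_mem _ hf)) x
    exact ⟨Λ, fun f ↦ (h1 f).trans (hψ' _), h2⟩

/-- Positivity of `φ` makes the images of nonnegative functions a positive family in `B`, so the
rank controls their norms. Injectivity of `π` makes it isometric, as the Hahn–Banach argument needs.
-/
lemma HasCPA.isDominated {H : Type*} [NormedAddCommGroup H] [InnerProductSpace ℂ H]
    [CompleteSpace H] {π : C(K, ℂ) →⋆ₙₐ[ℂ] (H →L[ℂ] H)} (hπ : Function.Injective π)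
    {Γ : Set C(K, ℝ)} {δ : ℝ} {r : ℕ} (h : HasCPA π (complexify '' Γ) δ r) :
    IsDominated Γ δ r := by
  obtain ⟨B, _, _, _, φ, ψ, _, rfl, hφ, hψ, h⟩ := h
  let ι : C(K, ℂ) →ₗᵢ[ℂ] (H →L[ℂ] H) :=
    { toFun := π
      map_add' := map_add π
      map_smul' := map_smul π
      norm_map' := NonUnitalStarAlgHom.norm_map π hπ }
  refine ⟨fun f ↦ ‖φ (complexify f)‖, fun f ↦ (hφ _).trans_eq (norm_complexify f),
    fun J s F hF ↦ ?_, fun x ↦ ?_⟩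
  · refine (sum_norm_le_cstarRank_mul s (fun i ↦ φ (complexify (F i))) fun i hi ↦
      map_nonneg φ (complexify_nonneg (hF i hi))).trans ?_
    rw [← map_sum, ← map_sum]
    gcongr
    exact (hφ _).trans_eq (norm_complexify _)
  · obtain ⟨Λ, h1, h2⟩ := exists_real_functional ι (ψ.toLinearMap ∘ₗ φ.toLinearMap)
      (fun f hf ↦ h _ (mem_image_of_mem _ hf)) x
    exact ⟨Λ, fun f ↦ (h1 f).trans (hψ _), h2⟩

end Complexification

/-! ### Passage to exponential growth rates. -/

section Comparison

lemma iInf_nat_eq_top_or_exists (P : ℕ → Prop) :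
    (⨅ (d : ℕ) (_ : P d), (d : ℕ∞)) = ⊤ ∨ ∃ d, P d ∧ (⨅ (d : ℕ) (_ : P d), (d : ℕ∞)) = d := by
  by_cases h : ∃ d, P d
  · classical
    refine Or.inr ⟨Nat.find h, Nat.find_spec h, le_antisymm (iInf₂_le _ (Nat.find_spec h)) ?_⟩
    exact le_iInf₂ fun d hd ↦ by exact_mod_cast Nat.find_min' h hd
  · refine Or.inl ?_
    simp only [iInf_eq_top]
    exact fun d hd ↦ absurd ⟨d, hd⟩ h

/-- The case `b = ⊤` covers the absence of any factorization; the right-hand side is then infinite.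
-/
lemma log_div_le_add {a b : ℕ∞} {ε : ℝ} {n : ℕ} (hn : 0 < n)
    (h : b = ⊤ ∨ ∃ d N : ℕ, b = d ∧ a ≤ N ∧ (N : ℝ) ≤ Real.exp (ε * n) * d) :
    ENNReal.log (a : ENNReal) / (n : EReal) ≤ ε + ENNReal.log (b : ENNReal) / (n : EReal) := by
  have hn' : (0 : ℝ) < n := by exact_mod_cast hn
  rcases h with rfl | ⟨d, N, rfl, haN, hN⟩
  · rw [ENat.toENNReal_top, ENNReal.log_top, EReal.top_div_of_pos_ne_top (by exact_mod_cast hn)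
      (EReal.natCast_ne_top n), EReal.coe_add_top]
    exact le_top
  · have h1 : (a : ENNReal) ≤ ENNReal.ofReal (Real.exp (ε * n)) * ((d : ℕ∞) : ENNReal) := by
      calc (a : ENNReal) ≤ ((N : ℕ∞) : ENNReal) := by exact_mod_cast haN
        _ = ENNReal.ofReal N := by simp
        _ ≤ ENNReal.ofReal (Real.exp (ε * n) * d) := ENNReal.ofReal_le_ofReal hN
        _ = _ := by rw [ENNReal.ofReal_mul (Real.exp_pos _).le]; simp
    have h2 := ENNReal.log_monotone h1
    rw [ENNReal.log_mul_add, ENNReal.log_ofReal_of_pos (Real.exp_pos _), Real.log_exp] at h2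
    refine (EReal.div_le_div_right_of_nonneg (by positivity) h2).trans_eq ?_
    rw [EReal.add_div_of_nonneg_right (by positivity)]
    congr 1
    have : ((n : EReal)) = ((n : ℝ) : EReal) := by simp
    rw [this, ← EReal.coe_div, mul_div_cancel_right₀ _ hn'.ne']

lemma complexify_image_subset_orbitUnion {K : Type*} [TopologicalSpace K] [CompactSpace K]
    (T : K ≃ₜ K) (s : Finset C(K, ℝ)) (n : ℕ) [DecidableEq C(K, ℂ)] :
    complexify '' {f | ∃ g ∈ s, ∃ k < n, f = g.comp ⟨T^[k], T.continuous.iterate k⟩} ⊆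
      orbitUnion (inducedAut T) (s.image complexify : Set C(K, ℂ)) n := by
  rintro _ ⟨_, ⟨g, hg, k, hk, rfl⟩, rfl⟩
  refine mem_iUnion₂.2 ⟨k, hk, complexify g, by simpa using ⟨g, hg, rfl⟩, ?_⟩
  ext x
  rw [inducedAut_iterate_apply]
  rfl

/-- Any entropy built from ranks of approximate factorizations which dominate point evaluations
bounds the topological entropy from above. -/
theorem topologicalEntropy_le_of_isDominated {K : Type*} [TopologicalSpace K] [CompactSpace K]
    [T2Space K] (T : K ≃ₜ K) (P : Set C(K, ℂ) → ℝ → ℕ → Prop)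
    (hP : ∀ (Γ : Set C(K, ℝ)) (Ω : Set C(K, ℂ)) (δ : ℝ) (r : ℕ), complexify '' Γ ⊆ Ω → P Ω δ r →
      IsDominated Γ δ r) :
    topologicalEntropy T ≤ ⨆ (Ω : Finset C(K, ℂ)) (δ : ℝ) (_ : 0 < δ),
      limsup (fun n : ℕ ↦ ENNReal.log ((⨅ (r : ℕ)
        (_ : P (orbitUnion (inducedAut T) (Ω : Set C(K, ℂ)) n) δ r), (r : ℕ∞) : ℕ∞) : ENNReal) /
          (n : EReal)) atTop := by
  classical
  refine iSup₂_le fun W hW ↦ ?_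
  rw [← EReal.le_of_forall_lt_iff_le]
  intro z hz
  obtain ⟨z', hz', hzz'⟩ := EReal.lt_iff_exists_real_btwn.1 hz
  have hε : 0 < z - z' := sub_pos.2 (by exact_mod_cast hzz')
  set ε := z - z' with hεdef
  obtain ⟨m, h, h01, hcov, hstar⟩ := exists_urysohn_star_refinement hW
  -- Half of the budget `ε / 2` goes to the overlap exponent; the other half absorbs the factor `2`
  -- for large `n`.
  obtain ⟨L, θ, hL, hθ, hθ1, hLθ⟩ := exists_small_exponent m (half_pos (half_pos hε))
  -- The constant `1` is included because near-positivity of the functionals depends on their value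
  -- at `1`.
  let s : Finset C(K, ℝ) := insert 1 (Finset.univ.image h)
  let Γ (n : ℕ) : Set C(K, ℝ) :=
    {f | ∃ g ∈ s, ∃ k < n, f = g.comp ⟨T^[k], T.continuous.iterate k⟩}
  let Ω : Finset C(K, ℂ) := s.image complexify
  let ρ (n : ℕ) : ℕ∞ := ⨅ (r : ℕ)
    (_ : P (orbitUnion (inducedAut T) (Ω : Set C(K, ℂ)) n) (θ / 8) r), (r : ℕ∞)
  have hρ : limsup (fun n : ℕ ↦ ENNReal.log (ρ n : ENNReal) / (n : EReal)) atTop ≤ z' := by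
    refine le_trans ?_ hz'.le
    exact le_iSup_of_le Ω (le_iSup₂_of_le (θ / 8) (by positivity) le_rfl)
  have hev : ∀ᶠ n : ℕ in atTop, ENNReal.log
      ((subcoverNumber (iteratedJoin T W n) : ℕ∞) : ENNReal) / (n : EReal) ≤
        ((ε / 2 : ℝ) : EReal) + ENNReal.log (ρ n : ENNReal) / (n : EReal) := by
    have hlarge : ∀ᶠ n : ℕ in atTop, Real.log 2 ≤ ε / 2 / 2 * n :=
      (tendsto_natCast_atTop_atTop.const_mul_atTop (half_pos (half_pos hε))).eventually_ge_atTop _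
    filter_upwards [hlarge, eventually_gt_atTop 0] with n hn2 hn
    refine log_div_le_add hn ?_
    refine (iInf_nat_eq_top_or_exists _).imp id ?_
    rintro ⟨d, hd, hdρ⟩
    have hdom : IsDominated (Γ n) (θ / 8) d :=
      hP _ _ _ _ (complexify_image_subset_orbitUnion T s n) hd
    obtain ⟨N, hN1, hN2⟩ := subcoverNumber_le_of_isDominated T h01 hcov hstar hL hθ hθ1 hn
      (Γ := Γ n) ⟨1, by simp [s], 0, hn, rfl⟩ (fun p k hk ↦ ⟨h p, by simp [s], k, hk, rfl⟩) hdom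
    refine ⟨d, N, hdρ, hN1, hN2.trans ?_⟩
    gcongr
    rw [← Real.log_le_iff_le_exp (by positivity), Real.log_mul two_ne_zero (Real.exp_pos _).ne',
      Real.log_exp]
    have : (L * θ + m * Real.exp (-L)) * n ≤ ε / 2 / 2 * n := by gcongr
    linarith
  have h1 : coverEntropyOf T W ≤ ((ε : ℝ) : EReal) + (z' : EReal) := by
    -- The slack between `ε / 2` and `ε` supplies the strict inequality used in adding limits
    -- superior.
    refine (limsup_le_limsup hev).trans (EReal.limsup_add_le_of_le ?_ hρ)
    rw [limsup_const]
    exact_mod_cast half_lt_self hε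
  refine h1.trans_eq ?_
  rw [← EReal.coe_add, hεdef, sub_add_cancel]

lemma HasCA.mono {X Y : Type*} [NormedAddCommGroup X] [NormedSpace ℂ X] [NormedAddCommGroup Y]
    [NormedSpace ℂ Y] {γ : X →L[ℂ] Y} {Ω Ω' : Set X} {δ : ℝ} {d : ℕ} (hΩ : Ω' ⊆ Ω)
    (h : HasCA γ Ω δ d) : HasCA γ Ω' δ d := by
  obtain ⟨hd, φ, ψ, hφ, hψ, h⟩ := h
  exact ⟨hd, φ, ψ, hφ, hψ, fun x hx ↦ h x (hΩ hx)⟩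

lemma HasCPA.mono {A : Type*} [NonUnitalCStarAlgebra A] [PartialOrder A] [StarOrderedRing A]
    {H : Type*} [NormedAddCommGroup H] [InnerProductSpace ℂ H] [CompleteSpace H]
    {π : A →⋆ₙₐ[ℂ] (H →L[ℂ] H)} {Ω Ω' : Set A} {δ : ℝ} {r : ℕ} (hΩ : Ω' ⊆ Ω)
    (h : HasCPA π Ω δ r) : HasCPA π Ω' δ r := by
  obtain ⟨B, i1, i2, i3, φ, ψ, hB, hr, hφ, hψ, h⟩ := h
  exact ⟨B, i1, i2, i3, φ, ψ, hB, hr, hφ, hψ, fun a ha ↦ h a (hΩ ha)⟩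

end Comparison

end

theorem proposition3 {K : Type u} [TopologicalSpace K] [CompactSpace K] [T2Space K]
    [Nonempty K] (T : K ≃ₜ K) :
    (∀ (H : Type v) [NormedAddCommGroup H] [InnerProductSpace ℂ H] [CompleteSpace H]
      (π : C(K, ℂ) →⋆ₙₐ[ℂ] (H →L[ℂ] H)), Function.Injective π →
      voiculescuBrownEntropy π (inducedAut T) = topologicalEntropy T) ∧
    (∀ (Y : Type w) [NormedAddCommGroup Y] [NormedSpace ℂ Y] [CompleteSpace Y]
      (ι : C(K, ℂ) →ₗᵢ[ℂ] Y), IsCAEmbedding ι →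
      caEntropy ι (inducedIsometry T) = topologicalEntropy T) := by
  refine ⟨fun H _ _ _ π hπ ↦ ?_, fun Y _ _ _ ι _ ↦ ?_⟩
  · exact le_antisymm (voiculescuBrownEntropy_le_topologicalEntropy T π)
      (topologicalEntropy_le_of_isDominated T (HasCPA π)
        fun _ _ _ _ hΩ h ↦ (h.mono hΩ).isDominated hπ)
  · exact le_antisymm (caEntropy_le_topologicalEntropy T ι)
      (topologicalEntropy_le_of_isDominated T (HasCA ι.toContinuousLinearMap)
        fun _ _ _ _ hΩ h ↦ (h.mono hΩ).isDominated)
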